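/- Consider $n\ge 1$ agents and $m\ge 0$ indivisible goods. Each agent $i$ has an additive valuation $v_i$ and an additive social impact function $s_i$, both with arbitrary non-negative real values on the goods. An allocation $A=(A_1,\dots,A_n)$ is a partition of all the goods into $n$ (possibly empty) bundles, where agent $i$ gets $A_i$. It is EF1 if for all agents $i,j$ either $A_j=\emptyset$ or there is a good $g\in A_j$ with $v_i(A_i)\ge v_i(A_j\setminus\{g\})$. Its utilitarian social impact is $\mathsf{SW}(A)=\sum_i s_i(A_i)$, and $\mathsf{opt}$ is the maximum of $\mathsf{SW}$ over all allocations (EF1 or not). There is an algorithm that, given $n$, $m$ and the numbers $v_i(g)$ and $s_i(g)$, computes an EF1 allocation $A$ with $\mathsf{opt}\le 2n^2\cdot\mathsf{SW}(A)$, and hence an $O(n^2)$-approximation of $\mathsf{opt}$. Its running time is polynomial: it is a single program of a random access machine that only adds, subtracts and compares numbers (with array access, and with each such operation counted as one step), and its number of steps is bounded by a fixed polynomial in $n+m$. -/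

import Mathlib

namespace SocialImpact

/-! ### Fair division with social impact -/

/-- An instance with agents `Fin n` and goods `Fin m`. Valuations and social impact functions are
additive, so they are given by their (non-negative real) values on single goods. -/
structure FairDivision (n m : ℕ) where
  /-- `val i g` is the value of good `g` for agent `i` -/
  val : Fin n → Fin m → ℝ
  /-- `impact i g` is the social impact of giving good `g` to agent `i` -/
  impact : Fin n → Fin m → ℝ
  val_nonneg : ∀ i g, 0 ≤ val i g
  impact_nonneg : ∀ i g, 0 ≤ impact i g

/-- A (complete) allocation: pairwise disjoint bundles that cover all the goods. -/
def IsAllocation {n m : ℕ} (A : Fin n → Finset (Fin m)) : Prop :=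
  (∀ i j, i ≠ j → Disjoint (A i) (A j)) ∧ ∀ g, ∃ i, g ∈ A i

namespace FairDivision

variable {n m : ℕ} (I : FairDivision n m)

/-- Value of the bundle `S` for agent `i`. -/
def value (i : Fin n) (S : Finset (Fin m)) : ℝ := ∑ g ∈ S, I.val i g

/-- Social impact of giving the bundle `S` to agent `i`. -/
def socialImpact (i : Fin n) (S : Finset (Fin m)) : ℝ := ∑ g ∈ S, I.impact i g

/-- Envy-freeness up to one good. -/
def EF1 (A : Fin n → Finset (Fin m)) : Prop :=
  ∀ i j, A j = ∅ ∨ ∃ g ∈ A j, I.value i ((A j).erase g) ≤ I.value i (A i)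

/-- Utilitarian social welfare: the sum of the agents' social impacts. -/
def socialWelfare (A : Fin n → Finset (Fin m)) : ℝ := ∑ i, I.socialImpact i (A i)

/-- The maximum of the utilitarian social welfare over all allocations (there are only finitely
many of them, and there is one as soon as `n` is positive). -/
noncomputable def opt : ℝ := sSup {x | ∃ A, IsAllocation A ∧ x = I.socialWelfare A}

end FairDivision

/-! ### Algorithms: a random access machine with a step count

A program works on finitely many two-dimensional arrays of natural numbers and finitely many
two-dimensional arrays of real numbers. It can only add, subtract and compare numbers, and address
array entries by computed natural numbers. There is no multiplication, no rounding, no real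
constant except `0`, and no way to turn a real number into an index: so unit costs are harmless,
since in `T` steps on binary encoded rational data all the numbers stay of a length polynomial in
`T` and the length of the input. -/

/-- The memory: `nat a i j` and `real a i j` are the entries `(i, j)` of the `a`-th array of
natural numbers and of the `a`-th array of real numbers. -/
structure Store where
  nat : ℕ → ℕ → ℕ → ℕ
  real : ℕ → ℕ → ℕ → ℝ

/-- Expressions for natural numbers; subtraction is truncated at `0`. -/
inductive NatExp where
  | const (k : ℕ)
  | get (a : ℕ) (i j : NatExp)
  | add (e f : NatExp)
  | sub (e f : NatExp)

/-- Expressions for real numbers. -/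
inductive RealExp where
  | zero
  | get (a : ℕ) (i j : NatExp)
  | add (e f : RealExp)
  | sub (e f : RealExp)

/-- Tests. -/
inductive Test where
  | natLe (e f : NatExp)
  | realLe (e f : RealExp)
  | not (b : Test)
  | and (b c : Test)

/-- Programs. The number of an array is part of the program, the indices are computed. -/
inductive Prog where
  | skip
  | setNat (a : ℕ) (i j e : NatExp)
  | setReal (a : ℕ) (i j : NatExp) (e : RealExp)
  | seq (p q : Prog)
  | ite (b : Test) (p q : Prog)
  | while (b : Test) (p : Prog)

/-- Value of an expression. -/
def NatExp.eval (σ : Store) : NatExp → ℕ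
  | const k => k
  | get a i j => σ.nat a (i.eval σ) (j.eval σ)
  | add e f => e.eval σ + f.eval σ
  | sub e f => e.eval σ - f.eval σ

/-- Number of steps taken by the evaluation of an expression. -/
def NatExp.cost : NatExp → ℕ
  | const _ => 1
  | get _ i j => i.cost + j.cost + 1
  | add e f => e.cost + f.cost + 1
  | sub e f => e.cost + f.cost + 1

/-- Value of an expression. -/
def RealExp.eval (σ : Store) : RealExp → ℝ
  | zero => 0
  | get a i j => σ.real a (i.eval σ) (j.eval σ)
  | add e f => e.eval σ + f.eval σ
  | sub e f => e.eval σ - f.eval σ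

/-- Number of steps taken by the evaluation of an expression. -/
def RealExp.cost : RealExp → ℕ
  | zero => 1
  | get _ i j => i.cost + j.cost + 1
  | add e f => e.cost + f.cost + 1
  | sub e f => e.cost + f.cost + 1

/-- Truth of a test. -/
def Test.Holds (σ : Store) : Test → Prop
  | natLe e f => e.eval σ ≤ f.eval σ
  | realLe e f => e.eval σ ≤ f.eval σ
  | not b => ¬ b.Holds σ
  | and b c => b.Holds σ ∧ c.Holds σ

/-- Number of steps taken by a test. -/
def Test.cost : Test → ℕ
  | natLe e f => e.cost + f.cost + 1
  | realLe e f => e.cost + f.cost + 1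
  | not b => b.cost + 1
  | and b c => b.cost + c.cost + 1

/-- Store `x` in the entry `(i, j)` of the `a`-th array of natural numbers. -/
def Store.setNat (σ : Store) (a i j x : ℕ) : Store where
  nat := fun a' i' j' => if a' = a ∧ i' = i ∧ j' = j then x else σ.nat a' i' j'
  real := σ.real

/-- Store `x` in the entry `(i, j)` of the `a`-th array of real numbers. -/
noncomputable def Store.setReal (σ : Store) (a i j : ℕ) (x : ℝ) : Store where
  nat := σ.nat
  real := fun a' i' j' => if a' = a ∧ i' = i ∧ j' = j then x else σ.real a' i' j'

/-- `Runs p σ σ' t`: the program `p`, started in the memory `σ`, stops after exactly `t` steps, and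
the memory is then `σ'`. (Programs are deterministic: `p` and `σ` determine `σ'` and `t`.) -/
inductive Runs : Prog → Store → Store → ℕ → Prop
  | skip (σ : Store) : Runs .skip σ σ 1
  | setNat (σ : Store) (a : ℕ) (i j e : NatExp) :
      Runs (.setNat a i j e) σ (σ.setNat a (i.eval σ) (j.eval σ) (e.eval σ))
        (i.cost + j.cost + e.cost + 1)
  | setReal (σ : Store) (a : ℕ) (i j : NatExp) (e : RealExp) :
      Runs (.setReal a i j e) σ (σ.setReal a (i.eval σ) (j.eval σ) (e.eval σ))
        (i.cost + j.cost + e.cost + 1)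
  | seq {p q : Prog} {σ₁ σ₂ σ₃ : Store} {t u : ℕ} :
      Runs p σ₁ σ₂ t → Runs q σ₂ σ₃ u → Runs (.seq p q) σ₁ σ₃ (t + u)
  | iteTrue {b : Test} {p q : Prog} {σ σ' : Store} {t : ℕ} :
      b.Holds σ → Runs p σ σ' t → Runs (.ite b p q) σ σ' (b.cost + t + 1)
  | iteFalse {b : Test} {p q : Prog} {σ σ' : Store} {t : ℕ} :
      ¬ b.Holds σ → Runs q σ σ' t → Runs (.ite b p q) σ σ' (b.cost + t + 1)
  | whileTrue {b : Test} {p : Prog} {σ₁ σ₂ σ₃ : Store} {t u : ℕ} :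
      b.Holds σ₁ → Runs p σ₁ σ₂ t → Runs (.while b p) σ₂ σ₃ u →
        Runs (.while b p) σ₁ σ₃ (b.cost + t + u + 1)
  | whileFalse {b : Test} {p : Prog} {σ : Store} :
      ¬ b.Holds σ → Runs (.while b p) σ σ (b.cost + 1)

/-- The memory at the start: the entries `(0, 0)` and `(1, 0)` of the array `0` of natural numbers
hold `n` and `m`, the arrays `0` and `1` of real numbers hold the valuations and the social impacts,
and everything else is `0`. -/
noncomputable def FairDivision.input {n m : ℕ} (I : FairDivision n m) : Store where
  nat := fun a i j =>
    if a = 0 ∧ i = 0 ∧ j = 0 then n else if a = 0 ∧ i = 1 ∧ j = 0 then m else 0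
  real := fun a i g =>
    if h : i < n ∧ g < m then
      if a = 0 then I.val ⟨i, h.1⟩ ⟨g, h.2⟩ else if a = 1 then I.impact ⟨i, h.1⟩ ⟨g, h.2⟩ else 0
    else 0

/-- The bundles that a final memory stands for: the entry `(g, 0)` of the array `1` of natural
numbers is the agent who gets the good `g`. -/
def Store.output (n m : ℕ) (σ : Store) : Fin n → Finset (Fin m) :=
  fun i => Finset.univ.filter fun g => σ.nat 1 g 0 = i

end SocialImpact

/-! Only one agent has to be served well. Let `a` have the greatest total impact $s_a(M)$, where $M$
is the set of all goods. Any allocation has impact at most $\sum_i s_i(M)\le n\,s_a(M)$, so it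
suffices to find an EF1 allocation with $s_a(M)\le 2n\,s_a(A_a)$ (`opt_le_of_impact_le`). This
inequality holds if `a` is EF1 with respect to $s_a$ instead of $v_a$ and $s_a(A_a)$ is at least the
impact of each single good: then every bundle has $s_a$-value at most $2s_a(A_a)$, and there are $n$
bundles (`BundleState.sum_le`).

The difficulty is that `a` must be EF1 for $v_a$ as well. Pad the goods with worthless ones to $nm$
and cut them, in decreasing order of $v_a$, into $m$ blocks of size $n$. If every bundle has exactly
one good of each block, then `a` is EF1 for $v_a$ whichever bundle `a` holds: without its good of
block 1, another bundle is dominated by the own one, block $k+1$ against block $k$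
(`BundleState.blocking_fair`). So `a` is free to act on $s_a$.

It remains to hand out the blocks one good per bundle, keeping EF1 for the utilities $u_a=s_a$ and
$u_i=v_i$ for $i\ne a$. Within a block, a bundle is marked once it has got its good. Envy cycles
among the holders of unmarked bundles are rotated away until some holder is a source, envied by no
such holder; the source takes its favourite remaining good of the block (`PickState.pick`). Unmarked
holders then lack envy after removal of the new good. Marked holders took something they like at
least as much as everything left, and keep it within the block; the invariant `ahead` records this.
The block with the good of greatest $s_a$ comes first, and `a` picks first in it. Afterwards the
value of `a`'s bundle never falls.

The search for a source runs for exactly $n^2+1$ rounds. Each round walks $n$ steps from an agent to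
an envier, which lands on a cycle, and rotates it. A proper cycle lowers `envyRank`, which is at
most $n^2$, so a source is reached (`SearchState`). All loops are therefore counting loops with
bounds fixed beforehand, and polynomial time follows by structural induction (`exists_runs`);
correctness is shown on the functional semantics `run` with `run_loop`. -/

namespace SocialImpact

open Polynomial

/-! ### Bounded programs -/

/-- Programs whose only loops are counting loops: `loop c a i p` runs `p` with the counter
`nat c 0 0` ranging over the numbers below `nat a i 0`. -/
inductive LoopProg where
  | skip
  | setNat (a : ℕ) (i j e : NatExp)
  | setReal (a : ℕ) (i j : NatExp) (e : RealExp)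
  | seq (p q : LoopProg)
  | ite (b : Test) (p q : LoopProg)
  | loop (c a i : ℕ) (p : LoopProg)

namespace LoopProg

/-- The scalar held by the array `a`. -/
abbrev _root_.SocialImpact.NatExp.var (a : ℕ) : NatExp := .get a (.const 0) (.const 0)

/-- Translation to programs. -/
def compile : LoopProg → Prog
  | skip => .skip
  | setNat a i j e => .setNat a i j e
  | setReal a i j e => .setReal a i j e
  | seq p q => .seq p.compile q.compile
  | ite b p q => .ite b p.compile q.compile
  | loop c a i p =>
    .seq (.setNat c (.const 0) (.const 0) (.const 0))
      (.while (.not (.natLe (.get a (.const i) (.const 0)) (.var c)))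
        (.seq p.compile (.setNat c (.const 0) (.const 0) (.add (.var c) (.const 1)))))

open Classical in
/-- The memory after the run of a program. -/
noncomputable def run : LoopProg → Store → Store
  | skip, σ => σ
  | setNat a i j e, σ => σ.setNat a (i.eval σ) (j.eval σ) (e.eval σ)
  | setReal a i j e, σ => σ.setReal a (i.eval σ) (j.eval σ) (e.eval σ)
  | seq p q, σ => q.run (p.run σ)
  | ite b p q, σ => if b.Holds σ then p.run σ else q.run σ
  | loop c a i p, σ =>
    Nat.rec (motive := fun _ => Store) (σ.setNat c 0 0 0)
      (fun k τ => (p.run τ).setNat c 0 0 (k + 1)) (σ.nat a i 0)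

/-- Does the program write to the array `a` of natural numbers? -/
def writesNat (a : ℕ) : LoopProg → Bool
  | skip => false
  | setNat b _ _ _ => b == a
  | setReal _ _ _ _ => false
  | seq p q => p.writesNat a || q.writesNat a
  | ite _ p q => p.writesNat a || q.writesNat a
  | loop c _ _ p => c == a || p.writesNat a

/-- Does the program write to the array `a` of real numbers? -/
def writesReal (a : ℕ) : LoopProg → Bool
  | skip => false
  | setNat _ _ _ _ => false
  | setReal b _ _ _ => b == a
  | seq p q => p.writesReal a || q.writesReal a
  | ite _ p q => p.writesReal a || q.writesReal a
  | loop _ _ _ p => p.writesReal a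

/-- All loop bounds are in arrays from `S`, to which the program does not write, and no loop body
writes to its own counter. -/
def admissible (S : List ℕ) : LoopProg → Bool
  | skip => true
  | setNat a _ _ _ => !S.contains a
  | setReal _ _ _ _ => true
  | seq p q => p.admissible S && q.admissible S
  | ite _ p q => p.admissible S && q.admissible S
  | loop c a _ p => S.contains a && !S.contains c && !p.writesNat c && p.admissible S

/-- A bound for the number of steps in terms of a bound for the loop bounds. -/
noncomputable def timeBound : LoopProg → ℕ[X]
  | skip => 1
  | setNat _ i j e => C (i.cost + j.cost + e.cost + 1)
  | setReal _ i j e => C (i.cost + j.cost + e.cost + 1)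
  | seq p q => p.timeBound + q.timeBound
  | ite b p q => C (b.cost + 1) + p.timeBound + q.timeBound
  -- One iteration costs 8 for the test, 8 for the increment and 1 for the loop step besides the
  -- body. The additive 13 is 4 for resetting the counter and 9 for the failing last test.
  | loop _ _ _ p => X * (p.timeBound + 17) + 13

/-! ### Semantics and cost of counting loops -/

theorem _root_.SocialImpact.Store.setNat_nat (σ : Store) (a i j x a' i' j' : ℕ) :
    (σ.setNat a i j x).nat a' i' j' = if a' = a ∧ i' = i ∧ j' = j then x else σ.nat a' i' j' := rfl

@[simp] theorem _root_.SocialImpact.Store.setNat_real (σ : Store) (a i j x : ℕ) :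
    (σ.setNat a i j x).real = σ.real := rfl

theorem _root_.SocialImpact.Store.setReal_real (σ : Store) (a i j : ℕ) (x : ℝ)
    (a' i' j' : ℕ) : (σ.setReal a i j x).real a' i' j' =
      if a' = a ∧ i' = i ∧ j' = j then x else σ.real a' i' j' := rfl

theorem _root_.SocialImpact.Store.setNat_nat_of_ne (σ : Store) {a a' : ℕ} (h : a' ≠ a)
    (i j x : ℕ) : (σ.setNat a i j x).nat a' = σ.nat a' := by
  funext i' j'; simp [Store.setNat_nat, h]

theorem _root_.SocialImpact.Store.setReal_real_of_ne (σ : Store) {a a' : ℕ} (h : a' ≠ a)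
    (i j : ℕ) (x : ℝ) : (σ.setReal a i j x).real a' = σ.real a' := by
  funext i' j'; simp [Store.setReal_real, h]

theorem run_nat_of_not_writes {a : ℕ} {p : LoopProg} (h : p.writesNat a = false) (σ : Store) :
    (p.run σ).nat a = σ.nat a := by
  induction p generalizing σ with
  | skip => rfl
  | setNat b i j e =>
    exact Store.setNat_nat_of_ne _ (by rintro rfl; simp [writesNat] at h) _ _ _
  | setReal => rfl
  | seq p q hp hq =>
    simp only [writesNat, Bool.or_eq_false_iff] at h
    simp [run, hp h.1, hq h.2]
  | ite b p q hp hq =>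
    simp only [writesNat, Bool.or_eq_false_iff] at h
    simp only [run]
    split_ifs
    exacts [hp h.1 σ, hq h.2 σ]
  | loop c b i p hp =>
    simp only [writesNat, Bool.or_eq_false_iff, beq_eq_false_iff_ne] at h
    simp only [run]
    induction σ.nat b i 0 with
    | zero => exact Store.setNat_nat_of_ne _ h.1.symm _ _ _
    | succ k ih =>
      exact (Store.setNat_nat_of_ne _ h.1.symm _ _ _).trans ((hp h.2 _).trans ih)

theorem run_real_of_not_writes {a : ℕ} {p : LoopProg} (h : p.writesReal a = false) (σ : Store) :
    (p.run σ).real a = σ.real a := by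
  induction p generalizing σ with
  | skip => rfl
  | setNat => rfl
  | setReal b i j e =>
    exact Store.setReal_real_of_ne _ (by rintro rfl; simp [writesReal] at h) _ _ _
  | seq p q hp hq =>
    simp only [writesReal, Bool.or_eq_false_iff] at h
    simp [run, hp h.1, hq h.2]
  | ite b p q hp hq =>
    simp only [writesReal, Bool.or_eq_false_iff] at h
    simp only [run]
    split_ifs
    exacts [hp h.1 σ, hq h.2 σ]
  | loop c b i p hp =>
    simp only [writesReal] at h
    simp only [run]
    induction σ.nat b i 0 with
    | zero => rfl
    | succ k ih => exact (hp h _).trans ih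

/-- This keeps the loop bounds constant during the whole run, so that one number `L` bounds them all
at every time. -/
theorem not_writesNat_of_admissible {S : List ℕ} {p : LoopProg} (h : p.admissible S = true)
    {a : ℕ} (ha : a ∈ S) : p.writesNat a = false := by
  induction p with
  | skip => rfl
  | setNat b i j e =>
    simp only [admissible, List.contains_eq_mem, Bool.not_eq_eq_eq_not, Bool.not_true,
      decide_eq_false_iff_not] at h
    simp only [writesNat, beq_eq_false_iff_ne]
    rintro rfl
    exact h ha
  | setReal => rfl
  | seq p q hp hq =>
    simp only [admissible, Bool.and_eq_true] at h
    simp [writesNat, hp h.1, hq h.2]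
  | ite b p q hp hq =>
    simp only [admissible, Bool.and_eq_true] at h
    simp [writesNat, hp h.1, hq h.2]
  | loop c b i p hp =>
    simp only [admissible, Bool.and_eq_true, List.contains_eq_mem, Bool.not_eq_eq_eq_not,
      Bool.not_true, decide_eq_false_iff_not] at h
    simp only [writesNat, hp h.2, Bool.or_false, beq_eq_false_iff_ne]
    rintro rfl
    exact h.1.1.2 ha

/-- Admissible programs stop within their time bound. -/
theorem exists_runs {S : List ℕ} {p : LoopProg} (h : p.admissible S = true) {L : ℕ} {σ : Store}
    (hL : ∀ a ∈ S, ∀ i, σ.nat a i 0 ≤ L) :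
    ∃ t ≤ p.timeBound.eval L, Runs p.compile σ (p.run σ) t := by
  induction p generalizing σ with
  | skip => exact ⟨1, by simp [timeBound], .skip σ⟩
  | setNat a i j e => exact ⟨_, by simp [timeBound], .setNat σ a i j e⟩
  | setReal a i j e => exact ⟨_, by simp [timeBound], .setReal σ a i j e⟩
  | seq p q hp hq =>
    simp only [admissible, Bool.and_eq_true] at h
    obtain ⟨t, ht, hr⟩ := hp h.1 hL
    obtain ⟨u, hu, hs⟩ := hq h.2 (σ := p.run σ) fun a ha i => by
      rw [run_nat_of_not_writes (not_writesNat_of_admissible h.1 ha)]; exact hL a ha i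
    exact ⟨t + u, by simp only [timeBound, eval_add]; omega, .seq hr hs⟩
  | ite b p q hp hq =>
    simp only [admissible, Bool.and_eq_true] at h
    simp only [run]
    split_ifs with hb
    · obtain ⟨t, ht, hr⟩ := hp h.1 hL
      exact ⟨_, by simp only [timeBound, eval_add, eval_C]; omega, .iteTrue hb hr⟩
    · obtain ⟨t, ht, hr⟩ := hq h.2 hL
      exact ⟨_, by simp only [timeBound, eval_add, eval_C]; omega, .iteFalse hb hr⟩
  | loop c b i p hp =>
    simp only [admissible, Bool.and_eq_true, List.contains_eq_mem, Bool.not_eq_eq_eq_not,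
      Bool.not_true, decide_eq_false_iff_not, decide_eq_true_eq] at h
    obtain ⟨⟨⟨hb, hc⟩, hpc⟩, hps⟩ := h
    set K := σ.nat b i 0 with hK
    let it : ℕ → Store := fun k => Nat.rec (motive := fun _ => Store) (σ.setNat c 0 0 0)
      (fun k τ => (p.run τ).setNat c 0 0 (k + 1)) k
    -- The counter of the functional iteration agrees with the one that the compiled loop
    -- increments, and the loop bound stays put.
    have hit : ∀ k, (it k).nat c 0 0 = k ∧ ∀ a ∈ S, (it k).nat a = σ.nat a := by
      intro k
      induction k with
      | zero =>
        exact ⟨by simp [it, Store.setNat_nat], fun a ha => Store.setNat_nat_of_ne _ (by rintro rfl; exact hc ha) _ _ _⟩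
      | succ k ih =>
        refine ⟨by simp [it, Store.setNat_nat], fun a ha => ?_⟩
        refine (Store.setNat_nat_of_ne _ (by rintro rfl; exact hc ha) _ _ _).trans ?_
        exact (run_nat_of_not_writes (not_writesNat_of_admissible hps ha) _).trans (ih.2 a ha)
    -- Induction on the number `d` of iterations still to come; the 9 pays for the failing test at
    -- the end.
    have hw : ∀ d k, d + k = K → ∃ t ≤ d * (p.timeBound.eval L + 17) + 9,
        Runs (.while (.not (.natLe (.get b (.const i) (.const 0)) (.var c)))
          (.seq p.compile (.setNat c (.const 0) (.const 0) (.add (.var c) (.const 1)))))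
          (it k) (it K) t := by
      intro d
      induction d with
      | zero =>
        intro k hk
        rw [show k = K by omega]
        refine ⟨_, ?_, .whileFalse ?_⟩
        · simp [Test.cost, NatExp.cost]
        · simp only [Test.Holds, NatExp.eval, (hit K).1, (hit K).2 b hb]
          simp [hK]
      | succ d ih =>
        intro k hk
        obtain ⟨t, ht, hr⟩ := hp hps (σ := it k) fun a ha i => by
          rw [(hit k).2 a ha]; exact hL a ha i
        obtain ⟨u, hu, hs⟩ := ih (k + 1) (by omega)
        have hstep := Runs.setNat (p.run (it k)) c (.const 0) (.const 0) (.add (.var c) (.const 1))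
        have he : ((p.run (it k)).setNat c 0 0 (k + 1)) = it (k + 1) := rfl
        simp only [NatExp.eval, run_nat_of_not_writes hpc, (hit k).1, he] at hstep
        refine ⟨_, ?_, .whileTrue ?_ (.seq hr hstep) hs⟩
        · simp only [Test.cost, NatExp.cost]
          rw [Nat.add_mul]
          omega
        · simp only [Test.Holds, NatExp.eval, (hit k).1, (hit k).2 b hb]
          omega
    obtain ⟨t, ht, hr⟩ := hw K 0 (by omega)
    refine ⟨_, ?_, .seq (.setNat σ c (.const 0) (.const 0) (.const 0)) hr⟩
    have := Nat.mul_le_mul_right (p.timeBound.eval L + 17) (hL b hb i)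
    simp only [timeBound, NatExp.cost, eval_add, eval_mul, eval_X]
    simp only [eval_ofNat]
    rw [← hK] at this
    omega

/-- Two memories agree on everything that `p` does not write to. -/
def Frame (p : LoopProg) (σ τ : Store) : Prop :=
  (∀ a, p.writesNat a = false → τ.nat a = σ.nat a) ∧
    ∀ a, p.writesReal a = false → τ.real a = σ.real a

theorem frame_run (p : LoopProg) (σ : Store) : p.Frame σ (p.run σ) :=
  ⟨fun _ h => run_nat_of_not_writes h σ, fun _ h => run_real_of_not_writes h σ⟩

/-- The invariant rule for loops. -/
theorem run_loop {c a i : ℕ} {p : LoopProg} {σ : Store}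
    (Inv : ℕ → Store → Prop) (K : ℕ) (hK : σ.nat a i 0 = K) (h0 : Inv 0 (σ.setNat c 0 0 0))
    (hs : ∀ k τ, k < K → τ.nat c 0 0 = k → (loop c a i p).Frame σ τ → Inv k τ →
      Inv (k + 1) ((p.run τ).setNat c 0 0 (k + 1))) :
    Inv K ((loop c a i p).run σ) := by
  subst hK
  simp only [run]
  suffices ∀ k ≤ σ.nat a i 0, Inv k (Nat.rec (motive := fun _ => Store) (σ.setNat c 0 0 0)
      (fun k τ => (p.run τ).setNat c 0 0 (k + 1)) k) from this _ le_rfl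
  intro k hk
  induction k with
  | zero => exact h0
  | succ k ih =>
    -- The rule hands the frame property of the loop to each iteration, so invariants need not
    -- mention the arrays that the loop leaves alone.
    refine hs k _ hk ?_ ⟨fun b hb => ?_, fun b hb => ?_⟩ (ih (by omega))
    · cases k <;> simp [Store.setNat_nat]
    · clear ih
      simp only [writesNat, Bool.or_eq_false_iff, beq_eq_false_iff_ne] at hb
      clear hk
      induction k with
      | zero => exact Store.setNat_nat_of_ne _ hb.1.symm _ _ _
      | succ k ih =>
        exact (Store.setNat_nat_of_ne _ hb.1.symm _ _ _).trans
          ((run_nat_of_not_writes hb.2 _).trans ih)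
    · clear ih
      clear hk
      induction k with
      | zero => rfl
      | succ k ih => exact (run_real_of_not_writes (p := p) hb _).trans ih

@[simp] theorem run_seq (p q : LoopProg) (σ : Store) : (seq p q).run σ = q.run (p.run σ) := rfl

@[simp] theorem run_setNat (a : ℕ) (i j e : NatExp) (σ : Store) :
    (setNat a i j e).run σ = σ.setNat a (i.eval σ) (j.eval σ) (e.eval σ) := rfl

@[simp] theorem run_setReal (a : ℕ) (i j : NatExp) (e : RealExp) (σ : Store) :
    (setReal a i j e).run σ = σ.setReal a (i.eval σ) (j.eval σ) (e.eval σ) := rfl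

@[simp] theorem run_skip (σ : Store) : skip.run σ = σ := rfl

theorem run_ite_pos {b : Test} {σ : Store} (h : b.Holds σ) (p q : LoopProg) :
    (ite b p q).run σ = p.run σ := by simp [run, h]

theorem run_ite_neg {b : Test} {σ : Store} (h : ¬ b.Holds σ) (p q : LoopProg) :
    (ite b p q).run σ = q.run σ := by simp [run, h]

end LoopProg

/-! ### Envy cycles -/

/-- The agents below `n` hold distinct bundles with numbers below `n`. -/
def IsAssignment (n : ℕ) (B : ℕ → ℕ) : Prop :=
  (∀ i < n, B i < n) ∧ Set.InjOn B (Set.Iio n)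

theorem IsAssignment.surj {n : ℕ} {B : ℕ → ℕ} (h : IsAssignment n B) {b : ℕ} (hb : b < n) :
    ∃ i < n, B i = b := by
  have := Finset.surj_on_of_inj_on_of_card_le (s := Finset.range n) (t := Finset.range n)
    (fun i _ => B i) (fun i hi => by simpa using h.1 i (by simpa using hi))
    (fun i j hi hj hij => h.2 (by simpa using hi) (by simpa using hj) hij) le_rfl b (by simpa)
  obtain ⟨i, hi, rfl⟩ := this
  exact ⟨i, by simpa using hi, rfl⟩

theorem IsAssignment.comp_swap {n : ℕ} {B : ℕ → ℕ} (h : IsAssignment n B) {x z : ℕ} (hx : x < n)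
    (hz : z < n) : IsAssignment n (B ∘ Equiv.swap x z) := by
  have hs : ∀ i < n, Equiv.swap x z i < n := by
    intro i hi
    rw [Equiv.swap_apply_def]
    split_ifs <;> assumption
  exact ⟨fun i hi => h.1 _ (hs i hi), fun i hi j hj hij =>
    (Equiv.swap x z).injective (h.2 (hs i hi) (hs j hj) hij)⟩

/-- Agents who hold unmarked bundles exchange them, and nobody is worse off. -/
structure Reassigns (n : ℕ) (got : ℕ → ℕ) (W : ℕ → ℕ → ℝ) (B B' : ℕ → ℕ) : Prop where
  isAssignment : IsAssignment n B'
  fixed : ∀ i < n, got (B i) ≠ 0 → B' i = B i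
  free : ∀ i < n, got (B i) = 0 → got (B' i) = 0
  mono : ∀ i < n, W i (B i) ≤ W i (B' i)

theorem Reassigns.refl {n : ℕ} {got : ℕ → ℕ} {W : ℕ → ℕ → ℝ} {B : ℕ → ℕ}
    (h : IsAssignment n B) : Reassigns n got W B B :=
  ⟨h, fun _ _ _ => rfl, fun _ _ h => h, fun _ _ => le_rfl⟩

theorem Reassigns.trans {n : ℕ} {got : ℕ → ℕ} {W : ℕ → ℕ → ℝ} {B B' B'' : ℕ → ℕ}
    (h : Reassigns n got W B B') (h' : Reassigns n got W B' B'') : Reassigns n got W B B'' where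
  isAssignment := h'.isAssignment
  fixed i hi hg := by
    rw [h'.fixed i hi (by rwa [h.fixed i hi hg]), h.fixed i hi hg]
  free i hi hg := h'.free i hi (h.free i hi hg)
  mono i hi := (h.mono i hi).trans (h'.mono i hi)

/-- No holder of an unmarked bundle envies `x`. -/
def IsSource (n : ℕ) (got : ℕ → ℕ) (W : ℕ → ℕ → ℝ) (B : ℕ → ℕ) (x : ℕ) : Prop :=
  ∀ j < n, got (B j) = 0 → W j (B x) ≤ W j (B j)

/-- `f x` is `x` for a source `x`, and otherwise a holder of an unmarked bundle who envies `x`. -/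
def IsEnvyTable (n : ℕ) (got : ℕ → ℕ) (W : ℕ → ℕ → ℝ) (B f : ℕ → ℕ) : Prop :=
  ∀ k < n, (f k = k ∧ IsSource n got W B k) ∨
    (f k < n ∧ got (B (f k)) = 0 ∧ W (f k) (B (f k)) < W (f k) (B k))

namespace IsEnvyTable

variable {n : ℕ} {got : ℕ → ℕ} {W : ℕ → ℕ → ℝ} {B f : ℕ → ℕ}

theorem lt (h : IsEnvyTable n got W B f) {k : ℕ} (hk : k < n) : f k < n := by
  rcases h k hk with h | h
  · rw [h.1]; exact hk
  · exact h.1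

theorem free (h : IsEnvyTable n got W B f) {k : ℕ} (hk : k < n) (hg : got (B k) = 0) :
    got (B (f k)) = 0 := by
  rcases h k hk with h | h
  · rw [h.1]; exact hg
  · exact h.2.1

theorem iterate (h : IsEnvyTable n got W B f) {k : ℕ} (hk : k < n) (hg : got (B k) = 0) (s : ℕ) :
    f^[s] k < n ∧ got (B (f^[s] k)) = 0 := by
  induction s with
  | zero => exact ⟨hk, hg⟩
  | succ s ih =>
    rw [Function.iterate_succ_apply']
    exact ⟨h.lt ih.1, h.free ih.1 ih.2⟩

/-- In the second alternative of the table the envy is strict, so `f k = k` would be strict envy of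
oneself. Hence the fixed points of the walk are exactly the sources. -/
theorem eq_self_iff (h : IsEnvyTable n got W B f) {k : ℕ} (hk : k < n) :
    f k = k ↔ IsSource n got W B k := by
  rcases h k hk with h | h
  · simp [h]
  · refine ⟨fun hf => ?_, fun hs => absurd (hs _ h.1 h.2.1) (not_le.2 h.2.2)⟩
    rw [hf] at h
    exact absurd h.2.2 (lt_irrefl _)

end IsEnvyTable

/-! ### Periodic points and the rotation of a cycle -/

/-- By pigeonhole an orbit inside `n` points repeats within its first `n + 1` terms, so after `n`
steps the walk is on the cycle. -/
theorem iterate_mem_periodicPts {n : ℕ} {f : ℕ → ℕ} {x : ℕ} (h : ∀ s, f^[s] x < n) :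
    f^[n] x ∈ Function.periodicPts f := by
  obtain ⟨i, hi, j, hj, hij, he⟩ := Finset.exists_ne_map_eq_of_card_lt_of_maps_to
    (s := Finset.range (n + 1)) (t := Finset.range n) (by simp) (f := fun s => f^[s] x)
    (fun s _ => by simpa using h s)
  wlog hlt : i < j generalizing i j
  · exact this j hj i hi hij.symm he.symm (by omega)
  simp only [Finset.mem_range] at hi hj
  refine ⟨j - i, by omega, ?_⟩
  change f^[j - i] (f^[n] x) = f^[n] x
  -- The repetition $f^i(x)=f^j(x)$ is pushed forward by $n-i$ further steps.
  have e1 : f^[n] x = f^[n - i] (f^[i] x) := by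
    rw [← Function.iterate_add_apply, Nat.sub_add_cancel (by omega)]
  have e2 : f^[j - i] (f^[n] x) = f^[n - i] (f^[j] x) := by
    rw [← Function.iterate_add_apply, ← Function.iterate_add_apply]
    exact congrArg (fun k => f^[k] x) (by omega)
  rw [e2, e1]
  exact congrArg _ he.symm

theorem minimalPeriod_le {n : ℕ} {f : ℕ → ℕ} {x : ℕ} (h : ∀ s, f^[s] x < n) :
    Function.minimalPeriod f x ≤ n := by
  have := Finset.card_le_card_of_injOn (s := Finset.range (Function.minimalPeriod f x))
    (t := Finset.range n) (fun s => f^[s] x) (fun s _ => by simpa using h s)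
    (fun i hi j hj hij => Function.iterate_injOn_Iio_minimalPeriod (by simpa using hi)
      (by simpa using hj) hij)
  simpa using this

/-- The state after `t` steps of the rotation of the cycle of `f` through `x`. -/
structure RotationState (f : ℕ → ℕ) (x : ℕ) (B₀ : ℕ → ℕ) (t z : ℕ) (B : ℕ → ℕ) : Prop where
  next : z = f^[min t (Function.minimalPeriod f x - 1) + 1] x
  base : B x = B₀ (f^[min t (Function.minimalPeriod f x - 1)] x)
  moved : ∀ s < min t (Function.minimalPeriod f x - 1), B (f^[s + 1] x) = B₀ (f^[s] x)
  fixed : ∀ i, (∀ s ≤ min t (Function.minimalPeriod f x - 1), i ≠ f^[s] x) → B i = B₀ i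

theorem RotationState.init (f : ℕ → ℕ) (x : ℕ) (B₀ : ℕ → ℕ) :
    RotationState f x B₀ 0 (f x) B₀ := ⟨by simp, by simp, by simp, fun _ _ => rfl⟩

/-- The pointer `z` returns to `x` only after $p-1$ swaps, where $p$ is the minimal period. From
then on the remaining rounds of the fixed-length loop do nothing, which is why the state is indexed
by $\min(t,p-1)$. -/
theorem RotationState.step_of_eq {f : ℕ → ℕ} {x : ℕ} {B₀ : ℕ → ℕ} {t z : ℕ} {B : ℕ → ℕ}
    (h : RotationState f x B₀ t z B) (hz : z = x) : RotationState f x B₀ (t + 1) z B := by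
  have h1 := h.next
  by_cases ht : t < Function.minimalPeriod f x - 1
  · rw [min_eq_left ht.le, hz] at h1
    exact absurd h1.symm
      (Function.not_isPeriodicPt_of_pos_of_lt_minimalPeriod (by omega) (by omega))
  · have e : min (t + 1) (Function.minimalPeriod f x - 1)
      = min t (Function.minimalPeriod f x - 1) := by omega
    exact ⟨by rw [e]; exact h.1, by rw [e]; exact h.2, by rw [e]; exact h.3, by rw [e]; exact h.4⟩

/-- The cycle is rotated by transpositions that use `x` as the temporary place: before the swap `x`
holds the original bundle of the predecessor of `z`. The swap gives that bundle to `z` and the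
original bundle of `z` to `x`. -/
theorem RotationState.step_of_ne {f : ℕ → ℕ} {x : ℕ} {B₀ : ℕ → ℕ} {t z : ℕ} {B : ℕ → ℕ}
    (h : RotationState f x B₀ t z B) (hx : x ∈ Function.periodicPts f) (hz : z ≠ x) :
    RotationState f x B₀ (t + 1) (f z) (B ∘ Equiv.swap x z) := by
  have hp := Function.minimalPeriod_pos_of_mem_periodicPts hx
  have hinj := Function.iterate_injOn_Iio_minimalPeriod (f := f) (x := x)
  set p := Function.minimalPeriod f x with hpdef
  have ht : t < p - 1 := by
    by_contra ht
    have h1 := h.next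
    rw [← hpdef, min_eq_right (by omega), Nat.sub_add_cancel hp, hpdef,
      Function.iterate_minimalPeriod] at h1
    exact hz h1
  have e0 : min t (p - 1) = t := by omega
  have e1 : min (t + 1) (p - 1) = t + 1 := by omega
  obtain ⟨h1, h2, h3, h4⟩ := h
  rw [← hpdef, e0] at h1 h2 h3 h4
  -- The point `z` is a new point of the cycle, so it still holds its original bundle.
  have hne : ∀ s ≤ t, z ≠ f^[s] x := by
    intro s hs he
    rw [h1] at he
    have := hinj (show t + 1 < p by omega) (show s < p by omega) he
    omega
  have hne' : ∀ s < t, f^[s + 1] x ≠ x := by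
    intro s hs he
    have := hinj (show s + 1 < p by omega) (show 0 < p by omega) he
    omega
  constructor
  · rw [← hpdef, e1, h1, Function.iterate_succ_apply' f (t + 1)]
  · rw [← hpdef, e1, ← h1]
    simp [h4 z hne]
  · rw [← hpdef, e1]
    intro s hs
    rcases Nat.lt_succ_iff_lt_or_eq.1 hs with hs | rfl
    · rw [Function.comp_apply, Equiv.swap_apply_of_ne_of_ne (hne' s hs) (hne (s + 1) hs).symm,
        h3 s hs]
    · rw [← h1]; simp [h2]
  · rw [← hpdef, e1]
    intro i hi
    have hiz : i ≠ z := by rw [h1]; exact hi _ le_rfl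
    have hix : i ≠ x := hi 0 (by omega)
    rw [Function.comp_apply, Equiv.swap_apply_of_ne_of_ne hix hiz, h4 i fun s hs => hi s (by omega)]

/-- The number of bundles that the agents prefer to their own. -/
noncomputable def envyRank (n : ℕ) (W : ℕ → ℕ → ℝ) (B : ℕ → ℕ) : ℕ :=
  ∑ i ∈ Finset.range n, ((Finset.range n).filter fun b => W i (B i) < W i b).card

theorem envyRank_le (n : ℕ) (W : ℕ → ℕ → ℝ) (B : ℕ → ℕ) : envyRank n W B ≤ n * n := by
  refine (Finset.sum_le_card_nsmul _ _ n fun i _ => ?_).trans (by simp)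
  exact (Finset.card_filter_le _ _).trans (by simp)

theorem envyRank_lt {n : ℕ} {W : ℕ → ℕ → ℝ} {B B' : ℕ → ℕ} (hB : ∀ i < n, B' i < n)
    (hm : ∀ i < n, W i (B i) ≤ W i (B' i)) {i : ℕ} (hi : i < n) (hs : W i (B i) < W i (B' i)) :
    envyRank n W B' < envyRank n W B := by
  have hsub : ∀ j < n, ((Finset.range n).filter fun b => W j (B' j) < W j b) ⊆
      (Finset.range n).filter fun b => W j (B j) < W j b := fun j hj b hb => by
    simp only [Finset.mem_filter] at hb ⊢
    exact ⟨hb.1, (hm j hj).trans_lt hb.2⟩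
  refine Finset.sum_lt_sum (fun j hj => Finset.card_le_card (hsub j (by simpa using hj)))
    ⟨i, by simpa, Finset.card_lt_card ?_⟩
  -- The bundle `B' i` was strictly preferred before and is now the own one, so it leaves the set.
  refine (Finset.ssubset_iff_of_subset (hsub i hi)).2 ⟨B' i, ?_, ?_⟩
  · simp [hB i hi, hs]
  · simp

/-- Since $p\le n$, `n` rounds complete the rotation: everybody on the cycle takes over the bundle
of the agent that `f` says they envy. A cycle of length one is a source and changes nothing; any
other cycle makes `f x` strictly better off. -/
theorem RotationState.reassigns {n : ℕ} {got : ℕ → ℕ} {W : ℕ → ℕ → ℝ} {f B₀ B : ℕ → ℕ} {x z : ℕ}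
    (hf : IsEnvyTable n got W B₀ f) (hx : x < n) (hg : got (B₀ x) = 0)
    (hp : x ∈ Function.periodicPts f) (hB : IsAssignment n B)
    (h : RotationState f x B₀ n z B) :
    Reassigns n got W B₀ B ∧ got (B x) = 0 ∧ (IsSource n got W B₀ x → B = B₀) ∧
      (IsSource n got W B₀ x ∨ envyRank n W B < envyRank n W B₀) := by
  have hlt := hf.iterate hx hg
  have hpn := minimalPeriod_le fun s => (hlt s).1
  have hpp := Function.minimalPeriod_pos_of_mem_periodicPts hp
  have hper : f^[Function.minimalPeriod f x - 1 + 1] x = x := by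
    rw [Nat.sub_add_cancel hpp, Function.iterate_minimalPeriod]
  set p := Function.minimalPeriod f x with hpdef
  have e : min n (p - 1) = p - 1 := by omega
  obtain ⟨-, h2, h3, h4⟩ := h
  rw [← hpdef, e] at h2 h3 h4
  have hcyc : ∀ s < p, B (f^[s + 1] x) = B₀ (f^[s] x) := by
    intro s hs
    rcases Nat.lt_or_ge s (p - 1) with h | h
    · exact h3 s h
    -- The cycle closes here: the last predecessor of `x` is $f^{p-1}(x)$, and its bundle ended up
    -- with `x`.
    · obtain rfl : s = p - 1 := by omega
      rw [hper, h2]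
  have hall : ∀ i, B i = B₀ i ∨ ∃ k, k < n ∧ got (B₀ k) = 0 ∧ i = f k ∧ B i = B₀ k := by
    intro i
    by_cases hi : ∀ s ≤ p - 1, i ≠ f^[s] x
    · exact Or.inl (h4 i hi)
    · push Not at hi
      obtain ⟨s, hs, rfl⟩ := hi
      right
      rcases s with - | s
      · refine ⟨f^[p - 1] x, (hlt _).1, (hlt _).2, ?_, h2⟩
        rw [← Function.iterate_succ_apply' f, Nat.succ_eq_add_one, hper]; rfl
      · exact ⟨f^[s] x, (hlt _).1, (hlt _).2, Function.iterate_succ_apply' .., hcyc s (by omega)⟩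
  have hR : Reassigns n got W B₀ B := by
    refine ⟨hB, fun i hi hgi => ?_, fun i hi hgi => ?_, fun i hi => ?_⟩
    · rcases hall i with h | ⟨k, hk, hgk, rfl, -⟩
      · exact h
      · exact absurd (hf.free hk hgk) hgi
    · rcases hall i with h | ⟨k, hk, hgk, rfl, h⟩ <;> rw [h]
      · exact hgi
      · exact hgk
    · rcases hall i with h | ⟨k, hk, hgk, rfl, h⟩ <;> rw [h]
      rcases hf k hk with h' | h'
      · rw [h'.1]
      · exact h'.2.2.le
  refine ⟨hR, hR.free x hx hg, fun hs => ?_, ?_⟩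
  · have hfx := (hf.eq_self_iff hx).2 hs
    have hp1 : p = 1 := Function.minimalPeriod_eq_one_iff_isFixedPt.2 hfx
    funext i
    by_cases hi : i = x
    · rw [hi, h2, hp1]; rfl
    · refine h4 i fun s hs => ?_
      rw [hp1] at hs
      obtain rfl : s = 0 := by omega
      exact hi
  · rcases hf x hx with h' | h'
    · exact Or.inl h'.2
    · refine Or.inr (envyRank_lt hB.1 hR.mono h'.1 ?_)
      have := hcyc 0 hpp
      simp only [zero_add, Function.iterate_one, Function.iterate_zero, id] at this
      rw [this]
      exact h'.2.2

/-- The state after `q` rounds of the search for a source, which starts at the agent `x₀`. -/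
structure SearchState (n : ℕ) (got : ℕ → ℕ) (W : ℕ → ℕ → ℝ) (B₀ : ℕ → ℕ) (x₀ q x : ℕ)
    (B : ℕ → ℕ) : Prop where
  lt : x < n
  free : got (B x) = 0
  reassigns : Reassigns n got W B₀ B
  source : IsSource n got W B₀ x₀ → x = x₀ ∧ B = B₀
  progress : IsSource n got W B x ∨ envyRank n W B + q ≤ n * n

theorem SearchState.init {n : ℕ} {got : ℕ → ℕ} {W : ℕ → ℕ → ℝ} {B₀ : ℕ → ℕ} {x₀ : ℕ}
    (hB : IsAssignment n B₀) (hx : x₀ < n) (hg : got (B₀ x₀) = 0) :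
    SearchState n got W B₀ x₀ 0 x₀ B₀ :=
  ⟨hx, hg, .refl hB, fun _ => ⟨rfl, rfl⟩, Or.inr (envyRank_le n W B₀)⟩

/-- Once the current agent is a source, walk and rotation both stand still, so surplus rounds are
harmless. Otherwise the walk reaches a source without any exchange, or the rotation lowers
`envyRank` by at least one. -/
theorem SearchState.step {n : ℕ} {got : ℕ → ℕ} {W : ℕ → ℕ → ℝ} {B₀ B B' f : ℕ → ℕ}
    {x₀ x q z : ℕ} (h : SearchState n got W B₀ x₀ q x B) (hf : IsEnvyTable n got W B f)
    (hB : IsAssignment n B') (hr : RotationState f (f^[n] x) B n z B') :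
    SearchState n got W B₀ x₀ (q + 1) (f^[n] x) B' := by
  have hit := hf.iterate h.lt h.free
  obtain ⟨h1, h2, h3, h4⟩ := hr.reassigns hf (hit n).1 (hit n).2
    (iterate_mem_periodicPts fun s => (hit s).1) hB
  have hx : IsSource n got W B x → f^[n] x = x := fun hs =>
    Function.iterate_fixed ((hf.eq_self_iff h.lt).2 hs) n
  refine ⟨(hit n).1, h2, h.reassigns.trans h1, fun hs => ?_, ?_⟩
  · obtain ⟨rfl, rfl⟩ := h.source hs
    rw [hx hs] at h3 ⊢
    exact ⟨rfl, h3 hs⟩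
  · rcases h.progress with hs | hq
    · left
      rw [h3 (by rwa [hx hs]), hx hs]
      exact hs
    · rcases h4 with h4 | h4
      · exact Or.inl (by rwa [h3 h4])
      · exact Or.inr (by omega)


/-! ### Handing out a block of goods -/

/-- Up to the removal of a good, `i` does not envy the bundle `b` after it has gained the
value `c`. -/
def NearlyEnvyFree (N : ℕ) (u : ℕ → ℕ → ℝ) (own : ℕ → ℕ) (W : ℕ → ℕ → ℝ) (B : ℕ → ℕ) (i b : ℕ)
    (c : ℝ) : Prop :=
  W i b + c ≤ W i (B i) ∨ ∃ g < N, own g = b + 1 ∧ W i b + c - u i g ≤ W i (B i)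

theorem NearlyEnvyFree.mono {N : ℕ} {u : ℕ → ℕ → ℝ} {own own' : ℕ → ℕ} {W W' : ℕ → ℕ → ℝ}
    {B B' : ℕ → ℕ} {i b : ℕ} {c c' : ℝ} (h : NearlyEnvyFree N u own W B i b c)
    (hown : ∀ g < N, own g = b + 1 → own' g = b + 1) (hb : W' i b + c' ≤ W i b + c)
    (hB : W i (B i) ≤ W' i (B' i)) : NearlyEnvyFree N u own' W' B' i b c' := by
  rcases h with h | ⟨g, hg, hgb, h⟩
  · exact Or.inl (by linarith)
  · exact Or.inr ⟨g, hg, hown g hg hgb, by linarith⟩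

/-- A fair partial allocation with at most one good from each block in each bundle. The good `g`
is in the bundle `b` if `own g = b + 1`, and `B i` is the bundle of the agent `i`. -/
structure BundleState (n N : ℕ) (u : ℕ → ℕ → ℝ) (blk own : ℕ → ℕ) (W : ℕ → ℕ → ℝ) (B : ℕ → ℕ) :
    Prop where
  isAssignment : IsAssignment n B
  own_le : ∀ g < N, own g ≤ n
  sum : ∀ i < n, ∀ b < n, W i b = ∑ g ∈ (Finset.range N).filter fun g => own g = b + 1, u i g
  fair : ∀ i < n, ∀ b < n, NearlyEnvyFree N u own W B i b 0
  inj : ∀ g < N, ∀ g' < N, blk g = blk g' → own g = own g' → own g ≠ 0 → g = g'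

/-- The state after `r` picks from the block `κ`: the bundles marked by `got` have got a good. -/
structure PickState (n N : ℕ) (u : ℕ → ℕ → ℝ) (blk done : ℕ → ℕ) (κ a : ℕ) (lb : ℝ) (r : ℕ)
    (own got : ℕ → ℕ) (W : ℕ → ℕ → ℝ) (B : ℕ → ℕ) : Prop
    extends BundleState n N u blk own W B where
  card_got : ((Finset.range n).filter fun b => got b ≠ 0).card = r
  card_own : ((Finset.range N).filter fun g => blk g = κ ∧ own g ≠ 0).card = r
  ahead : ∀ i < n, ∀ b < n, got (B i) ≠ 0 → got b = 0 → ∀ g < N, blk g = κ → own g = 0 →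
    NearlyEnvyFree N u own W B i b (u i g)
  marked : ∀ g < N, blk g = κ → own g ≠ 0 → got (own g - 1) ≠ 0
  other : ∀ g < N, blk g ≠ κ → (own g ≠ 0 ↔ done (blk g) ≠ 0)
  lower : lb ≤ W a (B a) ∨
    (r = 0 ∧ (∀ i < n, ∀ b < n, W i b = 0) ∧ ∃ g < N, blk g = κ ∧ lb ≤ u a g)

namespace PickState

variable {n N : ℕ} {u : ℕ → ℕ → ℝ} {blk done : ℕ → ℕ} {κ a : ℕ} {lb : ℝ} {r : ℕ} {own got : ℕ → ℕ}
  {W : ℕ → ℕ → ℝ} {B : ℕ → ℕ}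

theorem exists_free (h : PickState n N u blk done κ a lb r own got W B) (hr : r < n) :
    ∃ i < n, got (B i) = 0 := by
  have : ∃ b < n, got b = 0 := by
    by_contra! hb
    have := h.card_got
    rw [Finset.filter_true_of_mem fun b hb' => hb b (by simpa using hb'), Finset.card_range] at this
    omega
  obtain ⟨b, hb, hg⟩ := this
  obtain ⟨i, hi, rfl⟩ := h.isAssignment.surj hb
  exact ⟨i, hi, hg⟩

theorem exists_good (h : PickState n N u blk done κ a lb r own got W B) (hr : r < n)
    (hκ : ((Finset.range N).filter fun g => blk g = κ).card = n) :
    ∃ g < N, blk g = κ ∧ own g = 0 := by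
  by_contra! hb
  have := h.card_own
  rw [Finset.filter_congr (q := fun g => blk g = κ) fun g hg =>
    ⟨fun h => h.1, fun h => ⟨h, hb g (by simpa using hg) h⟩⟩, hκ] at this
  omega

theorem own_ne_zero (h : PickState n N u blk done κ a lb n own got W B)
    (hκ : ((Finset.range N).filter fun g => blk g = κ).card = n) {g : ℕ} (hg : g < N)
    (hgκ : blk g = κ) : own g ≠ 0 := by
  have hsub : ((Finset.range N).filter fun g => blk g = κ ∧ own g ≠ 0) ⊆
      (Finset.range N).filter fun g => blk g = κ := fun g hg => by
    simp only [Finset.mem_filter] at hg ⊢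
    exact ⟨hg.1, hg.2.1⟩
  have := Finset.eq_of_subset_of_card_le hsub (by rw [hκ, h.card_own])
  have hmem : g ∈ (Finset.range N).filter fun g => blk g = κ := by simp [hg, hgκ]
  rw [← this] at hmem
  simp only [Finset.mem_filter] at hmem
  exact hmem.2.2

theorem reassign (h : PickState n N u blk done κ a lb r own got W B) {B' : ℕ → ℕ} (ha : a < n)
    (hB : Reassigns n got W B B') : PickState n N u blk done κ a lb r own got W B' where
  isAssignment := hB.isAssignment
  own_le := h.own_le
  sum := h.sum
  fair i hi b hb := (h.fair i hi b hb).mono (fun _ _ h => h) le_rfl (hB.mono i hi)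
  inj := h.inj
  card_got := h.card_got
  card_own := h.card_own
  -- Whoever holds a marked bundle after the exchange held one before, because holders of unmarked
  -- bundles exchange only those.
  ahead i hi b hb hg hgb g hgN hgκ hg0 :=
    (h.ahead i hi b hb (fun h0 => hg (hB.free i hi h0)) hgb g hgN hgκ hg0).mono (fun _ _ h => h)
      le_rfl (hB.mono i hi)
  marked := h.marked
  other := h.other
  lower := h.lower.imp_left fun h => h.trans (hB.mono a ha)

theorem pick (h : PickState n N u blk done κ a lb r own got W B) (hu : ∀ i g, 0 ≤ u i g) {x : ℕ}
    (hx : x < n) (hgx : got (B x) = 0) (hs : IsSource n got W B x) {g₀ : ℕ} (hg₀ : g₀ < N)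
    (hκ : blk g₀ = κ) (hown : own g₀ = 0)
    (hmax : ∀ g < N, blk g = κ → own g = 0 → u x g ≤ u x g₀)
    (hxa : r = 0 → (∀ i < n, ∀ b < n, W i b = 0) → x = a) :
    PickState n N u blk done κ a lb (r + 1) (Function.update own g₀ (B x + 1))
      (Function.update got (B x) 1) (fun i b => if b = B x then W i b + u i g₀ else W i b) B := by
  have hBx := h.isAssignment.1 x hx
  have hBne : ∀ i < n, i ≠ x → B i ≠ B x := fun i hi hix hB => hix (h.isAssignment.2 hi hx hB)
  have hkeep : ∀ g b, own g = b + 1 → Function.update own g₀ (B x + 1) g = b + 1 := by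
    intro g b hg
    rw [Function.update_of_ne (by rintro rfl; omega)]
    exact hg
  have hWle : ∀ i, W i (B i) ≤ if B i = B x then W i (B i) + u i g₀ else W i (B i) := by
    intro i
    split_ifs
    · linarith [hu i g₀]
    · exact le_rfl
  -- An unmarked bundle has no good of the current block yet, which keeps the goods of a block in
  -- different bundles.
  have hmk : ∀ g < N, blk g = κ → own g ≠ B x + 1 := by
    intro g hg hgκ h1
    have := h.marked g hg hgκ (by omega)
    rw [h1] at this
    exact this hgx
  constructor
  · constructor
    · exact h.isAssignment
    · intro g hg
      rw [Function.update_apply]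
      split_ifs
      · omega
      · exact h.own_le g hg
    · intro i hi b hb
      split_ifs with hbx
      · subst hbx
        have : ((Finset.range N).filter fun g => Function.update own g₀ (B x + 1) g = B x + 1) =
            insert g₀ ((Finset.range N).filter fun g => own g = B x + 1) := by
          ext g
          simp only [Finset.mem_filter, Finset.mem_range, Finset.mem_insert, Function.update_apply]
          split_ifs with hgg
          · simp [hgg, hg₀]
          · simp [hgg]
        rw [this, Finset.sum_insert (by simp [hown]), h.sum i hi _ hb, add_comm]
      · rw [h.sum i hi b hb]
        refine Finset.sum_congr (Finset.filter_congr fun g _ => ?_) fun _ _ => rfl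
        rw [Function.update_apply]
        split_ifs with hgg
        · subst hgg; rw [hown]; omega
        · rfl
    · intro i hi b hb
      by_cases hbx : b = B x
      · subst hbx
        by_cases hix : i = x
        · subst hix; left; simp
        by_cases hgi : got (B i) = 0
        · right
          refine ⟨g₀, hg₀, by simp, ?_⟩
          simp only [hBne i hi hix, if_true, if_false]
          linarith [hs i hi hgi]
        · refine (h.ahead i hi _ hb hgi hgx g₀ hg₀ hκ hown).mono (fun g _ => hkeep g _) ?_ (hWle i)
          simp
      · exact (h.fair i hi b hb).mono (fun g _ => hkeep g _) (by simp [hbx]) (hWle i)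
    · intro g hg g' hg' hb ho hne
      rw [Function.update_apply, Function.update_apply] at ho
      rw [Function.update_apply] at hne
      split_ifs at ho hne with h1 h2 h2
      · rw [h1, h2]
      · exact absurd ho.symm (hmk g' hg' (by rw [← hb, h1, hκ]))
      · exact absurd ho (hmk g hg (by rw [hb, h2, hκ]))
      · exact h.inj g hg g' hg' hb ho hne
  · have : ((Finset.range n).filter fun b => Function.update got (B x) 1 b ≠ 0) =
        insert (B x) ((Finset.range n).filter fun b => got b ≠ 0) := by
      ext b
      simp only [Finset.mem_filter, Finset.mem_range, Finset.mem_insert, Function.update_apply]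
      split_ifs with hb
      · simp [hb, hBx]
      · simp [hb]
    rw [this, Finset.card_insert_of_notMem (by simp [hgx]), h.card_got]
  · have : ((Finset.range N).filter fun g =>
        blk g = κ ∧ Function.update own g₀ (B x + 1) g ≠ 0) =
        insert g₀ ((Finset.range N).filter fun g => blk g = κ ∧ own g ≠ 0) := by
      ext g
      simp only [Finset.mem_filter, Finset.mem_range, Finset.mem_insert, Function.update_apply]
      split_ifs with hb
      · simp [hb, hg₀, hκ]
      · simp [hb]
    rw [this, Finset.card_insert_of_notMem (by simp [hown]), h.card_own]
  · intro i hi b hb hgi hgb g hg hgκ hg0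
    have hbx : b ≠ B x := by rintro rfl; simp at hgb
    rw [Function.update_of_ne hbx] at hgb
    have hgg : g ≠ g₀ := by rintro rfl; simp at hg0
    rw [Function.update_of_ne hgg] at hg0
    -- For `x` itself, `ahead` is new: the gain `u x g₀` outweighs any remaining `u x g` that `b`
    -- may get, so the old fairness towards `b` carries over. The others merely keep what they had.
    by_cases hix : i = x
    · subst hix
      rcases h.fair i hi b hb with hf | ⟨g', hg', hgb', hf⟩
      · left
        simp only [hbx, if_true, if_false]
        linarith [hmax g hg hgκ hg0]
      · right
        refine ⟨g', hg', hkeep _ _ hgb', ?_⟩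
        simp only [hbx, if_true, if_false]
        linarith [hmax g hg hgκ hg0]
    · rw [Function.update_of_ne (hBne i hi hix)] at hgi
      exact (h.ahead i hi b hb hgi hgb g hg hgκ hg0).mono (fun g _ => hkeep g _) (by simp [hbx])
        (hWle i)
  · intro g hg hgκ hg0
    rw [Function.update_apply got]
    split_ifs with hgg
    · simp
    · rw [Function.update_apply] at hg0 hgg ⊢
      split_ifs at hg0 hgg ⊢
      · simp at hgg
      · exact h.marked g hg hgκ hg0
  · intro g hg hgκ
    rw [Function.update_of_ne (by rintro rfl; exact hgκ hκ)]
    exact h.other g hg hgκ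
  · left
    rcases h.lower with hl | ⟨hr, hW, g, hg, hgκ, hl⟩
    · exact hl.trans (hWle a)
    · obtain rfl := hxa hr hW
      -- At `r = 0` the whole block is available, so the good that witnesses `lb` can be picked, and
      -- the choice of `a` is at least as good.
      have hg0 : own g = 0 := by
        by_contra hne
        have hc := h.card_own
        rw [hr, Finset.card_eq_zero] at hc
        have : g ∈ (Finset.range N).filter fun g => blk g = κ ∧ own g ≠ 0 := by
          simp [hg, hgκ, hne]
        rw [hc] at this
        simp at this
      simp only [if_true]
      rw [hW x hx _ hBx]
      linarith [hmax g hg hgκ hg0]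

end PickState

/-- The blocks marked by `done` have been handed out. -/
structure BlockState (n N : ℕ) (u : ℕ → ℕ → ℝ) (blk done own : ℕ → ℕ) (W : ℕ → ℕ → ℝ)
    (B : ℕ → ℕ) : Prop extends BundleState n N u blk own W B where
  done_iff : ∀ g < N, own g ≠ 0 ↔ done (blk g) ≠ 0

theorem BlockState.init {n N : ℕ} {u : ℕ → ℕ → ℝ} {blk done own : ℕ → ℕ} {W : ℕ → ℕ → ℝ}
    {B : ℕ → ℕ} (hdone : ∀ κ, done κ = 0) (hown : ∀ g, own g = 0) (hW : ∀ i b, W i b = 0)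
    (hB : ∀ i < n, B i = i) : BlockState n N u blk done own W B where
  isAssignment := ⟨fun i hi => by rwa [hB i hi], fun i hi j hj h => by
    rwa [hB i hi, hB j hj] at h⟩
  own_le g _ := by simp [hown]
  sum i _ b _ := by simp [hW, hown]
  fair i _ b _ := Or.inl (by simp [hW])
  inj g _ g' _ _ _ h := absurd (hown g) h
  done_iff g _ := by simp [hown, hdone]

theorem BlockState.pickState {n N : ℕ} {u : ℕ → ℕ → ℝ} {blk done own : ℕ → ℕ} {W : ℕ → ℕ → ℝ}
    {B : ℕ → ℕ} (h : BlockState n N u blk done own W B) {κ a : ℕ} {lb : ℝ} {got : ℕ → ℕ}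
    (hκ : done κ = 0) (hgot : ∀ b < n, got b = 0)
    (hlb : lb ≤ W a (B a) ∨ ((∀ i < n, ∀ b < n, W i b = 0) ∧ ∃ g < N, blk g = κ ∧ lb ≤ u a g)) :
    PickState n N u blk done κ a lb 0 own got W B where
  toBundleState := h.toBundleState
  card_got := by
    rw [Finset.card_eq_zero, Finset.filter_eq_empty_iff]
    exact fun b hb => by simp [hgot b (by simpa using hb)]
  card_own := by
    rw [Finset.card_eq_zero, Finset.filter_eq_empty_iff]
    rintro g hg ⟨rfl, h1⟩
    exact (h.done_iff g (by simpa using hg)).1 h1 hκ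
  ahead i hi b hb hg := absurd (hgot _ (h.isAssignment.1 i hi)) hg
  marked g hg hgκ h1 := by
    subst hgκ
    exact absurd hκ ((h.done_iff g hg).1 h1)
  other g hg _ := h.done_iff g hg
  lower := hlb.imp_right fun h => ⟨rfl, h⟩

/-- After `n` picks the block of size `n` is used up. Since `n` is positive, the second alternative
of `lower`, which needs zero picks, is gone. -/
theorem PickState.blockState {n N : ℕ} {u : ℕ → ℕ → ℝ} {blk done : ℕ → ℕ} {κ a : ℕ} {lb : ℝ}
    {own got : ℕ → ℕ} {W : ℕ → ℕ → ℝ} {B : ℕ → ℕ}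
    (h : PickState n N u blk done κ a lb n own got W B) (hn : n ≠ 0)
    (hκ : ((Finset.range N).filter fun g => blk g = κ).card = n) {done' : ℕ → ℕ}
    (hd : done' κ ≠ 0) (hd' : ∀ k, k ≠ κ → done' k = done k) :
    BlockState n N u blk done' own W B ∧ lb ≤ W a (B a) := by
  refine ⟨⟨h.toBundleState, fun g hg => ?_⟩, h.lower.resolve_right fun h => hn h.1⟩
  by_cases hgκ : blk g = κ
  · simp [h.own_ne_zero hκ hg hgκ, hgκ, hd]
  · rw [hd' _ hgκ]
    exact h.other g hg hgκ

/-! ### Complete allocations -/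

/-- The goods below `N` are divided into the blocks `1, …, m` of size `n`, in order of
decreasing value. -/
structure IsBlocking (n m N : ℕ) (v : ℕ → ℝ) (blk : ℕ → ℕ) : Prop where
  pos : ∀ g < N, 1 ≤ blk g
  le : ∀ g < N, blk g ≤ m
  card : ∀ κ, 1 ≤ κ → κ ≤ m → ((Finset.range N).filter fun g => blk g = κ).card = n
  anti : ∀ g < N, ∀ g' < N, blk g < blk g' → v g' ≤ v g

/-- A block has `n` goods, they lie in different bundles, and there are `n` bundles, so every bundle
is hit. -/
theorem BundleState.exists_good {n m N : ℕ} {u : ℕ → ℕ → ℝ} {blk own : ℕ → ℕ} {W : ℕ → ℕ → ℝ}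
    {B : ℕ → ℕ} {v : ℕ → ℝ} (h : BundleState n N u blk own W B) (hb : IsBlocking n m N v blk)
    (hown : ∀ g < N, own g ≠ 0) {κ b : ℕ} (h1 : 1 ≤ κ) (hm : κ ≤ m) (hbn : b < n) :
    ∃ g < N, blk g = κ ∧ own g = b + 1 := by
  obtain ⟨g, hg, he⟩ := Finset.surj_on_of_inj_on_of_card_le
    (s := (Finset.range N).filter fun g => blk g = κ) (t := Finset.range n)
    (fun g _ => own g - 1) (fun g hg => by
      simp only [Finset.mem_filter, Finset.mem_range] at hg ⊢
      have := h.own_le g hg.1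
      have := hown g hg.1
      omega) (fun g g' hg hg' he => by
      simp only [Finset.mem_filter, Finset.mem_range] at hg hg'
      have h1 := hown g hg.1
      have h2 := hown g' hg'.1
      exact h.inj g hg.1 g' hg'.1 (by rw [hg.2, hg'.2]) (by omega) h1)
    (by rw [hb.card κ h1 hm, Finset.card_range]) b (by simpa)
  simp only [Finset.mem_filter, Finset.mem_range] at hg
  exact ⟨g, hg.1, hg.2, by have := hown g hg.1; omega⟩

/-- Whoever sorts the goods into blocks envies nobody up to one good. -/
theorem BundleState.blocking_fair {n m N : ℕ} {u : ℕ → ℕ → ℝ} {blk own : ℕ → ℕ} {W : ℕ → ℕ → ℝ}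
    {B : ℕ → ℕ} {v : ℕ → ℝ} (h : BundleState n N u blk own W B) (hb : IsBlocking n m N v blk)
    (hown : ∀ g < N, own g ≠ 0) (hm : 1 ≤ m) (hv : ∀ g, 0 ≤ v g) {b b' : ℕ} (hbn : b < n)
    (hbn' : b' < n) :
    ∃ g < N, own g = b' + 1 ∧ ∑ g ∈ (Finset.range N).filter fun g => own g = b' + 1, v g - v g ≤
      ∑ g ∈ (Finset.range N).filter fun g => own g = b + 1, v g := by
  have hex : ∀ b, b < n → ∀ k, ∃ g, k < m → g < N ∧ blk g = k + 1 ∧ own g = b + 1 := by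
    intro b hbn k
    by_cases hk : k < m
    · obtain ⟨g, hg⟩ := h.exists_good hb hown (κ := k + 1) (by omega) hk hbn
      exact ⟨g, fun _ => hg⟩
    · exact ⟨0, fun h => absurd h hk⟩
  have hsum : ∀ b, b < n → ∀ γ : ℕ → ℕ,
      (∀ k, k < m → γ k < N ∧ blk (γ k) = k + 1 ∧ own (γ k) = b + 1) →
      ∑ g ∈ (Finset.range N).filter fun g => own g = b + 1, v g =
        ∑ k ∈ Finset.range m, v (γ k) := by
    intro b _ γ hγ
    -- The map `γ` runs through the bundle block by block; its inverse is the block number, shifted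
    -- because blocks count from 1.
    symm
    refine Finset.sum_nbij' γ (fun g => blk g - 1) ?_ ?_ ?_ ?_ (fun _ _ => rfl)
    · intro k hk
      have := hγ k (by simpa using hk)
      simp [this.1, this.2.2]
    · intro g hg
      simp only [Finset.mem_filter, Finset.mem_range] at hg ⊢
      have := hb.pos g hg.1
      have := hb.le g hg.1
      omega
    · intro k hk
      simp [(hγ k (by simpa using hk)).2.1]
    · intro g hg
      simp only [Finset.mem_filter, Finset.mem_range] at hg
      have h1 := hb.pos g hg.1
      have h2 := hb.le g hg.1
      have h3 := hγ (blk g - 1) (by omega)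
      exact h.inj _ h3.1 g hg.1 (by omega) (by omega) (by omega)
  choose γ hγ using hex b hbn
  choose γ' hγ' using hex b' hbn'
  refine ⟨γ' 0, (hγ' 0 hm).1, (hγ' 0 hm).2.2, ?_⟩
  rw [hsum b hbn γ hγ, hsum b' hbn' γ' hγ']
  obtain ⟨l, rfl⟩ : ∃ l, m = l + 1 := ⟨m - 1, by omega⟩
  -- The first block is split off for `b'`, where it is the good removed, and the last block for
  -- `b`, where it is discarded as non-negative.
  rw [Finset.sum_range_succ', Finset.sum_range_succ (fun k => v (γ k))]
  have : ∑ k ∈ Finset.range l, v (γ' (k + 1)) ≤ ∑ k ∈ Finset.range l, v (γ k) := by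
    refine Finset.sum_le_sum fun k hk => ?_
    simp only [Finset.mem_range] at hk
    have h1 := hγ k (by omega)
    have h2 := hγ' (k + 1) (by omega)
    exact hb.anti _ h1.1 _ h2.1 (by omega)
  linarith [hv (γ l)]

/-- An agent whose bundle is worth the most valuable good has a fair share up to a factor `2`. -/
theorem BundleState.sum_le {n N : ℕ} {u : ℕ → ℕ → ℝ} {blk own : ℕ → ℕ} {W : ℕ → ℕ → ℝ}
    {B : ℕ → ℕ} (h : BundleState n N u blk own W B) (hown : ∀ g < N, own g ≠ 0) {a : ℕ} (ha : a < n)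
    (hu : ∀ i g, 0 ≤ u i g) (hmax : ∀ g < N, u a g ≤ W a (B a)) :
    ∑ g ∈ Finset.range N, u a g ≤ 2 * n * W a (B a) := by
  have hpos : 0 ≤ W a (B a) := by
    rw [h.sum a ha _ (h.isAssignment.1 a ha)]
    exact Finset.sum_nonneg fun _ _ => hu _ _
  have hsum : ∑ g ∈ Finset.range N, u a g = ∑ b ∈ Finset.range n, W a b := by
    rw [← Finset.sum_fiberwise_of_maps_to (s := Finset.range N) (t := Finset.range n)
      (g := fun g => own g - 1)]
    · refine Finset.sum_congr rfl fun b hb => ?_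
      rw [h.sum a ha b (by simpa using hb)]
      refine Finset.sum_congr (Finset.filter_congr fun g hg => ?_) fun _ _ => rfl
      have := hown g (by simpa using hg)
      omega
    · intro g hg
      simp only [Finset.mem_range] at hg ⊢
      have := hown g hg
      have := h.own_le g hg
      omega
  rw [hsum]
  -- By fairness a bundle exceeds the one of `a` by at most one good, and no good is worth more than
  -- the bundle of `a`.
  refine (Finset.sum_le_card_nsmul _ _ (2 * W a (B a)) fun b hb => ?_).trans (by
    simp; nlinarith)
  rcases h.fair a ha b (by simpa using hb) with h | ⟨g, hg, -, h⟩
  · linarith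
  · linarith [hmax g hg]


/-! ### From the memory to the allocation -/

namespace FairDivision

variable {n m : ℕ} (I : FairDivision n m)

theorem input_val (i : Fin n) (g : Fin m) : I.input.real 0 i g = I.val i g := by
  simp [input]

theorem input_impact (i : Fin n) (g : Fin m) : I.input.real 1 i g = I.impact i g := by
  simp [input]

theorem input_nonneg (a i g : ℕ) : 0 ≤ I.input.real a i g := by
  simp only [input]
  split_ifs
  exacts [I.val_nonneg _ _, I.impact_nonneg _ _, le_rfl, le_rfl]

theorem input_real_of_le {i g : ℕ} (h : n ≤ i ∨ m ≤ g) (a : ℕ) : I.input.real a i g = 0 :=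
  dif_neg (by omega)

/-- Padding costs nothing: the input memory reads `0` at goods beyond `m`, in values as in impacts.
-/
theorem sum_extend {N : ℕ} (hN : m ≤ N) (a i : ℕ) (P : ℕ → Prop) [DecidablePred P] :
    ∑ g ∈ (Finset.range N).filter P, I.input.real a i g =
      ∑ g ∈ Finset.univ.filter fun g : Fin m => P g, I.input.real a i g := by
  rw [Finset.sum_filter, Finset.sum_filter,
    ← Finset.sum_range fun g => if P g then I.input.real a i g else 0]
  symm
  refine Finset.sum_subset (by simpa using hN) fun g _ hg => ?_
  rw [I.input_real_of_le (Or.inr (by simpa using hg)), ite_self]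

theorem ef1_of_sums {N : ℕ} (hN : m ≤ N) {A : Fin n → Finset (Fin m)} {i j : Fin n} {P Q : ℕ → Prop}
    [DecidablePred P] [DecidablePred Q] (hP : ∀ g, g ∈ A i ↔ P g) (hQ : ∀ g, g ∈ A j ↔ Q g)
    (h : ∑ g ∈ (Finset.range N).filter Q, I.input.real 0 i g ≤
        ∑ g ∈ (Finset.range N).filter P, I.input.real 0 i g ∨
      ∃ g < N, Q g ∧ ∑ g ∈ (Finset.range N).filter Q, I.input.real 0 i g - I.input.real 0 i g ≤
        ∑ g ∈ (Finset.range N).filter P, I.input.real 0 i g) :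
    A j = ∅ ∨ ∃ g ∈ A j, I.value i ((A j).erase g) ≤ I.value i (A i) := by
  have hval : ∀ k (R : ℕ → Prop) [DecidablePred R], (∀ g, g ∈ A k ↔ R g) →
      ∑ g ∈ (Finset.range N).filter R, I.input.real 0 i g = I.value i (A k) := by
    intro k R _ hR
    rw [I.sum_extend hN, value]
    refine Finset.sum_congr ?_ fun g _ => I.input_val i g
    ext g; simp [hR]
  rw [hval i P hP, hval j Q hQ] at h
  have herase : ∀ g ∈ A j, I.value i ((A j).erase g) = I.value i (A j) - I.val i g := by
    intro g hg
    rw [value, value, ← Finset.add_sum_erase _ _ hg]; ring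
  have hle : I.value i (A j) ≤ I.value i (A i) →
      A j = ∅ ∨ ∃ g ∈ A j, I.value i ((A j).erase g) ≤ I.value i (A i) := by
    intro h
    rcases (A j).eq_empty_or_nonempty with he | ⟨g, hg⟩
    · exact Or.inl he
    · exact Or.inr ⟨g, hg, by rw [herase g hg]; linarith [I.val_nonneg i g]⟩
  rcases h with h | ⟨g, -, hg, h⟩
  · exact hle h
  · by_cases hgm : g < m
    · have hgA : (⟨g, hgm⟩ : Fin m) ∈ A j := (hQ _).2 hg
      exact Or.inr ⟨_, hgA, by rw [herase _ hgA, ← I.input_val]; exact h⟩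
    -- The removed good may be padding. It is worth nothing, so there was no envy at all, and any
    -- real good of the bundle can serve instead.
    · rw [I.input_real_of_le (Or.inr (by omega)), sub_zero] at h
      exact hle h

/-- One factor $n$ comes from replacing every agent's impact by the total of `a`, the factor $2n$
from the share that `a` gets. The impacts of the other agents in `A` are only bounded below by zero.
-/
theorem opt_le_of_impact_le {A : Fin n → Finset (Fin m)} (hA : IsAllocation A) {a : Fin n}
    (ha : ∀ i, ∑ g, I.impact i g ≤ ∑ g, I.impact a g)
    (hS : ∑ g, I.impact a g ≤ 2 * n * I.socialImpact a (A a)) :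
    I.opt ≤ 2 * (n : ℝ) ^ 2 * I.socialWelfare A := by
  refine csSup_le ⟨_, A, hA, rfl⟩ ?_
  rintro x ⟨A', -, rfl⟩
  have h1 : I.socialWelfare A' ≤ n * ∑ g, I.impact a g := by
    refine (Finset.sum_le_card_nsmul _ _ (∑ g, I.impact a g) fun i _ => ?_).trans (by simp)
    exact (Finset.sum_le_sum_of_subset_of_nonneg (Finset.subset_univ _)
      fun _ _ _ => I.impact_nonneg _ _).trans (ha i)
  have h2 : I.socialImpact a (A a) ≤ I.socialWelfare A :=
    Finset.single_le_sum (f := fun i => I.socialImpact i (A i))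
      (fun i _ => Finset.sum_nonneg fun _ _ => I.impact_nonneg _ _) (Finset.mem_univ a)
  calc I.socialWelfare A' ≤ n * ∑ g, I.impact a g := h1
    _ ≤ n * (2 * n * I.socialImpact a (A a)) := by gcongr
    _ = 2 * (n : ℝ) ^ 2 * I.socialImpact a (A a) := by ring
    _ ≤ _ := by gcongr

/-- A complete bundle state whose blocks are sorted by the values of `a`, and in which `a` is as
well off as with the good of the greatest impact, gives a good allocation. -/
theorem output_of_bundleState {N : ℕ} (hN : m ≤ N) (hm : 1 ≤ m) {a : ℕ} (ha : a < n)
    {u : ℕ → ℕ → ℝ} {blk own : ℕ → ℕ} {W : ℕ → ℕ → ℝ} {B : ℕ → ℕ}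
    (hu : ∀ i g, u i g = if i = a then I.input.real 1 i g else I.input.real 0 i g)
    (h : BundleState n N u blk own W B) (hown : ∀ g < N, own g ≠ 0)
    (hb : IsBlocking n m N (I.input.real 0 a) blk)
    (hbest : ∀ i < n, ∑ g ∈ Finset.range m, I.input.real 1 i g ≤
      ∑ g ∈ Finset.range m, I.input.real 1 a g)
    (hmax : ∀ g < N, u a g ≤ W a (B a)) {σ : Store}
    (hσ : ∀ g < m, ∀ i < n, own g = B i + 1 → σ.nat 1 g 0 = i) :
    IsAllocation (σ.output n m) ∧ I.EF1 (σ.output n m) ∧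
      I.opt ≤ 2 * (n : ℝ) ^ 2 * I.socialWelfare (σ.output n m) := by
  have hex : ∀ g : Fin m, ∃ i : Fin n, own g = B i + 1 := by
    intro g
    have h1 := h.own_le g (by omega)
    have h2 := hown g (by omega)
    obtain ⟨i, hi, hBi⟩ := h.isAssignment.surj (b := own g - 1) (by omega)
    exact ⟨⟨i, hi⟩, by simp only [hBi]; omega⟩
  have hmem : ∀ (i : Fin n) (g : Fin m), g ∈ σ.output n m i ↔ own g = B i + 1 := by
    intro i g
    simp only [Store.output, Finset.mem_filter, Finset.mem_univ, true_and]
    refine ⟨fun hg => ?_, hσ g g.2 i i.2⟩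
    obtain ⟨j, hj⟩ := hex g
    rw [hσ g g.2 j j.2 hj] at hg
    rw [hj, hg]
  have hA : IsAllocation (σ.output n m) := by
    refine ⟨fun i j hij => ?_, fun g => ?_⟩
    · rw [Finset.disjoint_left]
      intro g hi hj
      rw [hmem] at hi hj
      exact hij (Fin.ext (h.isAssignment.2 i.2 j.2 (by omega)))
    · obtain ⟨i, hi⟩ := hex g
      exact ⟨i, (hmem i g).2 hi⟩
  have hu0 : ∀ i g, 0 ≤ u i g := by
    intro i g
    rw [hu]
    split_ifs <;> exact I.input_nonneg _ _ _
  refine ⟨hA, fun i j => ?_, ?_⟩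
  · refine I.ef1_of_sums hN (P := fun g => own g = B i + 1) (Q := fun g => own g = B j + 1)
      (hmem i) (hmem j) ?_
    -- The bundle state is fair to `a` for impacts, not for values. For `a` the fairness in values
    -- comes from the blocks.
    by_cases hia : (i : ℕ) = a
    · right
      rw [hia]
      exact h.blocking_fair hb hown hm (I.input_nonneg 0 a) (h.isAssignment.1 a ha)
        (h.isAssignment.1 j j.2)
    · have hui : u i = I.input.real 0 i := by funext g; rw [hu, if_neg hia]
      have hf := h.fair i i.2 _ (h.isAssignment.1 j j.2)
      simp only [NearlyEnvyFree, h.sum i i.2 _ (h.isAssignment.1 j j.2),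
        h.sum i i.2 _ (h.isAssignment.1 i i.2), hui, add_zero] at hf
      exact hf
  · have hsum : ∀ i : Fin n, ∑ g ∈ Finset.range m, I.input.real 1 i g = ∑ g, I.impact i g := by
      intro i
      rw [Finset.sum_range]
      exact Finset.sum_congr rfl fun g _ => I.input_impact i g
    refine I.opt_le_of_impact_le hA (a := ⟨a, ha⟩) (fun i => ?_) ?_
    · rw [← hsum, ← hsum]
      exact hbest i i.2
    · have hs := h.sum_le hown ha hu0 hmax
      have hua : u a = I.input.real 1 a := by funext g; rw [hu, if_pos rfl]
      have hT : I.socialImpact ⟨a, ha⟩ (σ.output n m ⟨a, ha⟩) = W a (B a) := by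
        rw [h.sum a ha _ (h.isAssignment.1 a ha), hua, I.sum_extend hN, socialImpact]
        refine Finset.sum_congr ?_ fun g _ => (I.input_impact ⟨a, ha⟩ g).symm
        ext g; simp [hmem]
      rw [hT, ← hsum]
      refine le_trans ?_ hs
      rw [hua]
      exact Finset.sum_le_sum_of_subset_of_nonneg (by simpa using hN)
        fun _ _ _ => I.input_nonneg _ _ _

end FairDivision

/-! ### The algorithm

The arrays of natural numbers: `0` input, `1` output, `2` number of goods after padding, `3` number
of rounds of the search for a source, `4` the favoured agent plus one, `5` blocks of the goods,
`6` bundles of the goods plus one, `7` bundles of the agents, `8` marks of the bundles, `9` envy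
table, `10` current agent, `11`, `12` auxiliary, `13` current good plus one, `14` good of the
greatest impact plus one, `15` marks of the blocks, `16` current block, `20`, `21`, … counters.
The arrays of real numbers: `0`, `1` input, `2` values of the goods, `3` values of the bundles,
`4` total impacts. -/

/-- The array `a` as a one-dimensional array. -/
def Store.arr (σ : Store) (a : ℕ) : ℕ → ℕ := fun i => σ.nat a i 0

theorem Store.nat_eq_arr (σ : Store) (a i : ℕ) : σ.nat a i 0 = σ.arr a i := rfl

theorem Store.arr_setNat (σ : Store) (a i x a' : ℕ) : (σ.setNat a i 0 x).arr a' =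
    if a' = a then Function.update (σ.arr a) i x else σ.arr a' := by
  funext i'
  simp only [Store.arr, Store.setNat_nat]
  split_ifs with h1 h2 h3
  · simp [h1.2.1]
  · exact absurd h1.1 h2
  · subst h3
    rw [Function.update_of_ne (by rintro rfl; simp at h1)]
    rfl
  · rfl

theorem Store.real_setReal (σ : Store) (a i j : ℕ) (x : ℝ) (a' : ℕ) :
    (σ.setReal a i j x).real a' =
      if a' = a then fun i' j' => if i' = i ∧ j' = j then x else σ.real a i' j'
      else σ.real a' := by
  funext i' j'
  simp only [Store.setReal_real]
  by_cases h : a' = a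
  · subst h; simp
  · simp [h]

/-- The entry `i` of the one-dimensional array `a`. -/
abbrev NatExp.elem (a : ℕ) (i : NatExp) : NatExp := .get a i (.const 0)

/-- Equality of natural numbers. -/
abbrev Test.natEq (e f : NatExp) : Test := .and (.natLe e f) (.natLe f e)

/-! ### Programs for maxima and for the search for a source -/

namespace LoopProg

open NatExp in
/-- Store the value of `e` in the entry `i` of the one-dimensional array `a`. -/
abbrev setElem (a : ℕ) (i e : NatExp) : LoopProg := .setNat a i (const 0) e

/-- Store the value of `e` in the scalar `a`. -/
abbrev setVar (a : ℕ) (e : NatExp) : LoopProg := .setNat a (.const 0) (.const 0) e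

theorem Frame.arr {p : LoopProg} {σ τ : Store} (h : p.Frame σ τ) (a : ℕ)
    (ha : p.writesNat a = false) : τ.arr a = σ.arr a := by
  funext i; simp only [Store.arr, h.1 a ha]

theorem run_arr (p : LoopProg) (σ : Store) (a : ℕ) (ha : p.writesNat a = false) :
    (p.run σ).arr a = σ.arr a := (frame_run p σ).arr a ha

theorem run_real (p : LoopProg) (σ : Store) (a : ℕ) (ha : p.writesReal a = false) :
    (p.run σ).real a = σ.real a := (frame_run p σ).2 a ha

open NatExp Test

/-- Store in the scalar `r` the successor of an index `k` with `cond k` and the greatest score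
among the numbers below `nat a i 0`, and `0` if there is none. -/
def argmax (c a i r : ℕ) (cond : NatExp → Test) (score : NatExp → RealExp) : LoopProg :=
  .seq (setVar r (const 0)) <| .loop c a i <|
    .ite (.and (cond (var c)) (.not (.and (natLe (const 1) (var r))
        (.not (realLe (score (.sub (var r) (const 1))) (score (var c)))))))
      (setVar r (.add (var c) (const 1))) .skip

/-- The hypothesis `h` says that test and score ignore the two scalars that the loop changes; so
they are a fixed predicate and a fixed function. It is needed for arbitrary index expressions
because the loop compares the counter with the stored candidate. -/
theorem run_argmax {c a i r : ℕ} {cond : NatExp → Test} {score : NatExp → RealExp} {σ : Store}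
    (hrc : r ≠ c) (hra : r ≠ a) (P : ℕ → Prop) (F : ℕ → ℝ)
    (h : ∀ τ : Store, (∀ b, b ≠ r → b ≠ c → τ.arr b = σ.arr b) → τ.real = σ.real →
      ∀ e : NatExp, ((cond e).Holds τ ↔ P (e.eval τ)) ∧ (score e).eval τ = F (e.eval τ)) :
    (((argmax c a i r cond score).run σ).arr r 0 = 0 ∧ ∀ g < σ.arr a i, ¬ P g) ∨
      ∃ g < σ.arr a i, ((argmax c a i r cond score).run σ).arr r 0 = g + 1 ∧ P g ∧
        ∀ g' < σ.arr a i, P g' → F g' ≤ F g := by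
  simp only [argmax, run_seq]
  refine run_loop (fun k τ => (τ.arr r 0 = 0 ∧ ∀ g < k, ¬ P g) ∨
      ∃ g < k, τ.arr r 0 = g + 1 ∧ P g ∧ ∀ g' < k, P g' → F g' ≤ F g) (σ.arr a i) ?_ ?_ ?_
  · simp [Store.nat_eq_arr, NatExp.eval, Store.arr_setNat, hra.symm]
  · left
    simp [NatExp.eval, Store.arr_setNat, hrc]
  · intro k τ hk hc hfr hinv
    have hτ : (∀ b, b ≠ r → b ≠ c → τ.arr b = σ.arr b) := by
      intro b hbr hbc
      rw [hfr.arr b (by simp [writesNat, hbr.symm, hbc.symm])]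
      simp [Store.arr_setNat, NatExp.eval, hbr]
    have hτ' : τ.real = σ.real := by
      funext b; exact hfr.2 b rfl
    rw [Store.nat_eq_arr] at hc
    have h1 := h τ hτ hτ' (var c)
    have h2 := h τ hτ hτ' (.sub (var r) (const 1))
    simp only [NatExp.eval, Store.nat_eq_arr, hc] at h1 h2
    -- The candidate is replaced unless there is one with a strictly greater score. While there is
    -- none, the truncated index `0 - 1` is shielded by the guard `1 ≤ r`.
    by_cases hb : P k ∧ ¬ (1 ≤ τ.arr r 0 ∧ ¬ F (τ.arr r 0 - 1) ≤ F k)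
    · rw [run_ite_pos (by
        simp only [Test.Holds, h1, h2, NatExp.eval, Store.nat_eq_arr]; exact hb)]
      right
      refine ⟨k, by omega, ?_, hb.1, ?_⟩
      · simp [Store.arr_setNat, NatExp.eval, hrc, Store.nat_eq_arr, hc]
      · intro g' hg' hP
        rcases Nat.lt_succ_iff_lt_or_eq.1 hg' with hg' | rfl
        · rcases hinv with ⟨-, hi⟩ | ⟨g, hg, hr, hPg, hi⟩
          · exact absurd hP (hi g' hg')
          · have hb2 := hb.2
            simp only [hr] at hb2
            push Not at hb2
            exact (hi g' hg' hP).trans (hb2 (by omega))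
        · exact le_rfl
    · rw [run_ite_neg (by
        simp only [Test.Holds, h1, h2, NatExp.eval, Store.nat_eq_arr]; exact hb)]
      simp only [run_skip, Store.arr_setNat, if_neg hrc]
      push Not at hb
      rcases hinv with ⟨hr, hi⟩ | ⟨g, hg, hr, hPg, hi⟩
      · left
        refine ⟨hr, fun g hg hP => ?_⟩
        rcases Nat.lt_succ_iff_lt_or_eq.1 hg with hg | rfl
        · exact hi g hg hP
        · have := (hb hP).1
          omega
      · right
        refine ⟨g, by omega, hr, hPg, fun g' hg' hP => ?_⟩
        rcases Nat.lt_succ_iff_lt_or_eq.1 hg' with hg' | rfl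
        · exact hi g' hg' hP
        · have := (hb hP).2
          rw [hr] at this
          exact this.le

/-- Compute the envy table. -/
def findEnvy : LoopProg :=
  .loop 20 0 0 <| .seq (setElem 9 (var 20) (var 20)) <| .loop 21 0 0 <|
    .ite (.and (natLe (elem 8 (elem 7 (var 21))) (const 0))
        (.not (realLe (.get 3 (var 21) (elem 7 (var 20))) (.get 3 (var 21) (elem 7 (var 21))))))
      (setElem 9 (var 20) (var 21)) .skip

theorem run_findEnvy (σ : Store) : IsEnvyTable (σ.arr 0 0) (σ.arr 8) (σ.real 3) (σ.arr 7)
    ((findEnvy.run σ).arr 9) := by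
  refine run_loop (fun k τ => ∀ l < k, (τ.arr 9 l = l ∧
      IsSource (σ.arr 0 0) (σ.arr 8) (σ.real 3) (σ.arr 7) l) ∨ (τ.arr 9 l < σ.arr 0 0 ∧
      σ.arr 8 (σ.arr 7 (τ.arr 9 l)) = 0 ∧ σ.real 3 (τ.arr 9 l) (σ.arr 7 (τ.arr 9 l)) <
        σ.real 3 (τ.arr 9 l) (σ.arr 7 l))) (σ.arr 0 0) rfl (fun l hl => absurd hl (by omega)) ?_
  intro k τ hk hc hfr hinv
  rw [Store.nat_eq_arr] at hc
  simp only [run_seq]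
  have h := run_loop (c := 21) (a := 0) (i := 0)
    (p := .ite (.and (natLe (elem 8 (elem 7 (var 21))) (const 0))
        (.not (realLe (.get 3 (var 21) (elem 7 (var 20))) (.get 3 (var 21) (elem 7 (var 21))))))
      (setElem 9 (var 20) (var 21)) .skip) (σ := (setElem 9 (var 20) (var 20)).run τ)
    (fun j υ => (∀ l ≠ k, υ.arr 9 l = τ.arr 9 l) ∧ ((υ.arr 9 k = k ∧
      IsSource j (σ.arr 8) (σ.real 3) (σ.arr 7) k) ∨ (υ.arr 9 k < σ.arr 0 0 ∧
      σ.arr 8 (σ.arr 7 (υ.arr 9 k)) = 0 ∧ σ.real 3 (υ.arr 9 k) (σ.arr 7 (υ.arr 9 k)) <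
        σ.real 3 (υ.arr 9 k) (σ.arr 7 k)))) (σ.arr 0 0) ?_ ?_ ?_
  · intro l hl
    simp only [Store.arr_setNat, show (9 : ℕ) ≠ 20 by decide, if_false]
    by_cases hlk : l = k
    · subst hlk; exact h.2
    · rw [h.1 l hlk]
      exact hinv l (by omega)
  · simp [Store.nat_eq_arr, Store.arr_setNat, NatExp.eval, hfr.arr 0 rfl]
  · refine ⟨fun l hl => ?_, Or.inl ⟨?_, fun j hj => absurd hj (by omega)⟩⟩
    · simp [Store.nat_eq_arr, Store.arr_setNat, NatExp.eval, hc, hl]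
    · simp [Store.nat_eq_arr, Store.arr_setNat, NatExp.eval, hc]
  · intro j υ hj hcj hfr' hinv'
    rw [Store.nat_eq_arr] at hcj
    have e20 : υ.arr 20 0 = k := by
      rw [hfr'.arr 20 rfl]; simp [Store.nat_eq_arr, Store.arr_setNat, NatExp.eval, hc]
    have e7 : υ.arr 7 = σ.arr 7 := by
      rw [hfr'.arr 7 rfl, run_arr _ _ 7 rfl, hfr.arr 7 rfl]
    have e8 : υ.arr 8 = σ.arr 8 := by
      rw [hfr'.arr 8 rfl, run_arr _ _ 8 rfl, hfr.arr 8 rfl]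
    have e3 : υ.real 3 = σ.real 3 := by
      rw [hfr'.2 3 rfl, run_real _ _ 3 rfl, hfr.2 3 rfl]
    by_cases hb : σ.arr 8 (σ.arr 7 j) ≤ 0 ∧
        ¬ σ.real 3 j (σ.arr 7 k) ≤ σ.real 3 j (σ.arr 7 j)
    · rw [run_ite_pos (by
        simp only [Test.Holds, NatExp.eval, RealExp.eval, Store.nat_eq_arr, hcj, e20, e7, e8, e3]
        exact hb)]
      simp only [run_setNat, NatExp.eval, Store.nat_eq_arr, hcj, e20, Store.arr_setNat]
      refine ⟨fun l hl => ?_, Or.inr ?_⟩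
      · simp [hl, hinv'.1 l hl]
      · simp only [show (9 : ℕ) ≠ 21 by decide, if_false, if_true, Function.update_self]
        exact ⟨hj, by omega, not_le.1 hb.2⟩
    · rw [run_ite_neg (by
        simp only [Test.Holds, NatExp.eval, RealExp.eval, Store.nat_eq_arr, hcj, e20, e7, e8, e3]
        exact hb)]
      simp only [run_skip, Store.arr_setNat, show (9 : ℕ) ≠ 21 by decide, if_false]
      refine ⟨hinv'.1, hinv'.2.imp_left fun h => ⟨h.1, fun j' hj' hg => ?_⟩⟩
      rcases Nat.lt_succ_iff_lt_or_eq.1 hj' with hj' | rfl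
      · exact h.2 j' hj' hg
      · by_contra hle
        exact hb ⟨by omega, hle⟩

/-- Follow the envy table. -/
def walk : LoopProg := .loop 20 0 0 (setVar 10 (elem 9 (var 10)))

theorem run_walk (σ : Store) :
    (walk.run σ).arr 10 0 = (σ.arr 9)^[σ.arr 0 0] (σ.arr 10 0) := by
  refine run_loop (fun k τ => τ.arr 10 0 = (σ.arr 9)^[k] (σ.arr 10 0)) (σ.arr 0 0) rfl rfl ?_
  intro k τ hk hc hfr hinv
  simp [NatExp.eval, Store.nat_eq_arr, Store.arr_setNat, hfr.arr 9 rfl, hinv,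
    Function.iterate_succ_apply']

/-- Exchange the bundles along the cycle through the current agent. -/
def rotate : LoopProg :=
  .seq (setVar 11 (elem 9 (var 10))) <| .loop 20 0 0 <|
    .ite (natEq (var 11) (var 10)) .skip <|
      .seq (setVar 12 (elem 7 (var 10))) <| .seq (setElem 7 (var 10) (elem 7 (var 11))) <|
      .seq (setElem 7 (var 11) (var 12)) (setVar 11 (elem 9 (var 11)))

theorem run_rotate {σ : Store} (hB : IsAssignment (σ.arr 0 0) (σ.arr 7))
    (hf : ∀ k < σ.arr 0 0, σ.arr 9 k < σ.arr 0 0) (hx : σ.arr 10 0 < σ.arr 0 0)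
    (hp : σ.arr 10 0 ∈ Function.periodicPts (σ.arr 9)) :
    IsAssignment (σ.arr 0 0) ((rotate.run σ).arr 7) ∧
      ∃ z, RotationState (σ.arr 9) (σ.arr 10 0) (σ.arr 7) (σ.arr 0 0) z
        ((rotate.run σ).arr 7) := by
  have h : IsAssignment (σ.arr 0 0) ((rotate.run σ).arr 7) ∧ (rotate.run σ).arr 11 0 < σ.arr 0 0 ∧
      RotationState (σ.arr 9) (σ.arr 10 0) (σ.arr 7) (σ.arr 0 0) ((rotate.run σ).arr 11 0)
        ((rotate.run σ).arr 7) := by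
    refine run_loop (fun k τ => IsAssignment (σ.arr 0 0) (τ.arr 7) ∧ τ.arr 11 0 < σ.arr 0 0 ∧
        RotationState (σ.arr 9) (σ.arr 10 0) (σ.arr 7) k (τ.arr 11 0) (τ.arr 7)) (σ.arr 0 0)
        ?_ ?_ ?_
    · simp [NatExp.eval, Store.nat_eq_arr, Store.arr_setNat]
    · simp only [run_setNat, NatExp.eval, Store.nat_eq_arr, Store.arr_setNat]
      exact ⟨hB, hf _ hx, RotationState.init _ _ _⟩
    · rintro k τ hk - hfr ⟨h1, h2, h3⟩
      have e10 : τ.arr 10 = σ.arr 10 := by rw [hfr.arr 10 rfl, run_arr _ _ 10 rfl]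
      have e9 : τ.arr 9 = σ.arr 9 := by rw [hfr.arr 9 rfl, run_arr _ _ 9 rfl]
      by_cases hz : τ.arr 11 0 = σ.arr 10 0
      · rw [run_ite_pos (by
          simp only [Test.Holds, NatExp.eval, Store.nat_eq_arr, e10]; omega)]
        simp only [run_skip, Store.arr_setNat]
        exact ⟨h1, h2, h3.step_of_eq hz⟩
      · rw [run_ite_neg (by
          simp only [Test.Holds, NatExp.eval, Store.nat_eq_arr, e10]; omega)]
        -- The three assignments through the auxiliary scalar amount to a composition with a
        -- transposition.
        have e7 : Function.update (Function.update (τ.arr 7) (σ.arr 10 0) (τ.arr 7 (τ.arr 11 0)))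
            (τ.arr 11 0) (τ.arr 7 (σ.arr 10 0)) =
            τ.arr 7 ∘ Equiv.swap (σ.arr 10 0) (τ.arr 11 0) := by
          rw [Equiv.comp_swap_eq_update]
          exact Function.update_comm (Ne.symm hz) _ _ _
        simp [NatExp.eval, Store.nat_eq_arr, Store.arr_setNat, e10, e9, e7]
        exact ⟨h1.comp_swap hx h2, hf _ h2, h3.step_of_ne hp hz⟩
  exact ⟨h.1, _, h.2.2⟩

/-- Remove envy cycles until the current agent is a source. -/
def search : LoopProg := .loop 22 3 0 (.seq findEnvy (.seq walk rotate))

theorem run_search {σ : Store} (hB : IsAssignment (σ.arr 0 0) (σ.arr 7))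
    (hx : σ.arr 10 0 < σ.arr 0 0) (hg : σ.arr 8 (σ.arr 7 (σ.arr 10 0)) = 0) :
    SearchState (σ.arr 0 0) (σ.arr 8) (σ.real 3) (σ.arr 7) (σ.arr 10 0) (σ.arr 3 0)
      ((search.run σ).arr 10 0) ((search.run σ).arr 7) := by
  refine run_loop (fun k τ => SearchState (σ.arr 0 0) (σ.arr 8) (σ.real 3) (σ.arr 7) (σ.arr 10 0) k
      (τ.arr 10 0) (τ.arr 7)) (σ.arr 3 0) rfl (.init hB hx hg) ?_
  rintro k τ hk - hfr hinv
  have e0 : τ.arr 0 = σ.arr 0 := hfr.arr 0 rfl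
  have e8 : τ.arr 8 = σ.arr 8 := hfr.arr 8 rfl
  have e3 : τ.real 3 = σ.real 3 := hfr.2 3 rfl
  simp only [run_seq]
  have hf := run_findEnvy τ
  rw [e0, e8, e3] at hf
  set τ₁ := findEnvy.run τ with hτ₁
  have w1 := run_walk τ₁
  set τ₂ := walk.run τ₁ with hτ₂
  have h0 : τ₁.arr 0 = σ.arr 0 := (run_arr _ _ 0 rfl).trans e0
  have h0' : τ₂.arr 0 = σ.arr 0 := (run_arr _ _ 0 rfl).trans h0
  have h7 : τ₂.arr 7 = τ.arr 7 := (run_arr _ _ 7 rfl).trans (run_arr _ _ 7 rfl)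
  have h9 : τ₂.arr 9 = τ₁.arr 9 := run_arr _ _ 9 rfl
  have h10 : τ₁.arr 10 = τ.arr 10 := run_arr _ _ 10 rfl
  rw [h0, h10] at w1
  have hit := hf.iterate hinv.lt hinv.free
  have hr := run_rotate (σ := τ₂)
  rw [h0', h7, h9, w1] at hr
  obtain ⟨r1, z, r2⟩ := hr hinv.reassigns.isAssignment (fun k hk => hf.lt hk) (hit _).1
    (iterate_mem_periodicPts fun s => (hit s).1)
  have h10' : (rotate.run τ₂).arr 10 = τ₂.arr 10 := run_arr _ _ 10 rfl
  simp only [Store.arr_setNat]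
  simp only [show (10 : ℕ) ≠ 22 by decide, show (7 : ℕ) ≠ 22 by decide, if_false, h10', w1]
  exact hinv.step hf r1 r2

end LoopProg

/-- The program updates values only in the rows of agents below `n`, whereas `PickState.pick`
describes an update in all rows. -/
theorem PickState.congr {n N : ℕ} {u : ℕ → ℕ → ℝ} {blk done : ℕ → ℕ} {κ a : ℕ} {lb : ℝ} {r : ℕ}
    {own got : ℕ → ℕ} {W W' : ℕ → ℕ → ℝ} {B : ℕ → ℕ}
    (h : PickState n N u blk done κ a lb r own got W B) (ha : a < n)
    (hW : ∀ i < n, ∀ b, W' i b = W i b) : PickState n N u blk done κ a lb r own got W' B where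
  isAssignment := h.isAssignment
  own_le := h.own_le
  sum i hi b hb := by rw [hW i hi, h.sum i hi b hb]
  fair i hi b hb := (h.fair i hi b hb).mono (fun _ _ h => h) (by rw [hW i hi]) (by rw [hW i hi])
  inj := h.inj
  card_got := h.card_got
  card_own := h.card_own
  ahead i hi b hb h1 h2 g h3 h4 h5 := (h.ahead i hi b hb h1 h2 g h3 h4 h5).mono (fun _ _ h => h)
    (by rw [hW i hi]) (by rw [hW i hi])
  marked := h.marked
  other := h.other
  lower := by
    rw [hW a ha]
    exact h.lower.imp_right fun h => ⟨h.1, fun i hi b hb => by rw [hW i hi, h.2.1 i hi b hb], h.2.2⟩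

/-! ### Programs for a single pick and for a whole block -/

namespace LoopProg

open NatExp Test

/-- Choose an agent with an unmarked bundle, if possible the favoured one. -/
def start : LoopProg :=
  .seq (setVar 10 (.sub (var 4) (const 1))) <|
    .ite (natLe (elem 8 (elem 7 (var 10))) (const 0)) .skip <| .loop 20 0 0 <|
      .ite (natLe (elem 8 (elem 7 (var 20))) (const 0)) (setVar 10 (var 20)) .skip

/-- The last clause is what lets the favoured agent open the first block. -/
theorem run_start {σ : Store} {a : ℕ} (h4 : σ.arr 4 0 = a + 1) (ha : a < σ.arr 0 0)
    (hex : ∃ i < σ.arr 0 0, σ.arr 8 (σ.arr 7 i) = 0) :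
    (start.run σ).arr 10 0 < σ.arr 0 0 ∧ σ.arr 8 (σ.arr 7 ((start.run σ).arr 10 0)) = 0 ∧
      (σ.arr 8 (σ.arr 7 a) = 0 → (start.run σ).arr 10 0 = a) := by
  simp only [start, run_seq]
  set τ := (setVar 10 (.sub (var 4) (const 1))).run σ with hτ
  have t10 : τ.arr 10 0 = a := by
    simp [hτ, NatExp.eval, Store.nat_eq_arr, Store.arr_setNat, h4]
  have t0 : τ.arr 0 = σ.arr 0 := run_arr _ _ 0 rfl
  have t7 : τ.arr 7 = σ.arr 7 := run_arr _ _ 7 rfl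
  have t8 : τ.arr 8 = σ.arr 8 := run_arr _ _ 8 rfl
  by_cases hga : σ.arr 8 (σ.arr 7 a) = 0
  · rw [run_ite_pos (by
      simp only [Test.Holds, NatExp.eval, Store.nat_eq_arr, t10, t7, t8]; omega)]
    simp only [run_skip, t10]
    exact ⟨ha, hga, fun _ => trivial⟩
  · rw [run_ite_neg (by
      simp only [Test.Holds, NatExp.eval, Store.nat_eq_arr, t10, t7, t8]; omega)]
    have h := run_loop (c := 20) (a := 0) (i := 0)
      (p := .ite (natLe (elem 8 (elem 7 (var 20))) (const 0)) (setVar 10 (var 20)) .skip) (σ := τ)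
      (fun k υ => (υ.arr 10 0 < σ.arr 0 0 ∧ σ.arr 8 (σ.arr 7 (υ.arr 10 0)) = 0) ∨
        ∀ i < k, σ.arr 8 (σ.arr 7 i) ≠ 0) (σ.arr 0 0) (by rw [Store.nat_eq_arr, t0])
      (Or.inr fun i hi => absurd hi (by omega)) ?_
    · rcases h with h | h
      · exact ⟨h.1, h.2, fun h => absurd h hga⟩
      · obtain ⟨i, hi, hg⟩ := hex
        exact absurd hg (h i hi)
    · intro k υ hk hc hfr hinv
      rw [Store.nat_eq_arr] at hc
      have e7 : υ.arr 7 = σ.arr 7 := (hfr.arr 7 rfl).trans t7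
      have e8 : υ.arr 8 = σ.arr 8 := (hfr.arr 8 rfl).trans t8
      by_cases hg : σ.arr 8 (σ.arr 7 k) = 0
      · rw [run_ite_pos (by
          simp only [Test.Holds, NatExp.eval, Store.nat_eq_arr, hc, e7, e8]; omega)]
        left
        simp [NatExp.eval, Store.nat_eq_arr, Store.arr_setNat, hc, hk, hg]
      · rw [run_ite_neg (by
          simp only [Test.Holds, NatExp.eval, Store.nat_eq_arr, hc, e7, e8]; omega)]
        simp only [run_skip, Store.arr_setNat, show (10 : ℕ) ≠ 20 by decide, if_false]
        refine hinv.imp_right fun h i hi => ?_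
        rcases Nat.lt_succ_iff_lt_or_eq.1 hi with hi | rfl
        · exact h i hi
        · exact hg

/-- The best unassigned good of the current block for the current agent. -/
def choose : LoopProg :=
  argmax 20 2 0 13 (fun e => .and (natEq (elem 5 e) (var 16)) (natLe (elem 6 e) (const 0)))
    fun e => .get 2 (var 10) e

theorem run_choose {σ : Store}
    (hex : ∃ g < σ.arr 2 0, σ.arr 5 g = σ.arr 16 0 ∧ σ.arr 6 g = 0) :
    ∃ g < σ.arr 2 0, (choose.run σ).arr 13 0 = g + 1 ∧ (σ.arr 5 g = σ.arr 16 0 ∧ σ.arr 6 g = 0) ∧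
      ∀ g' < σ.arr 2 0, σ.arr 5 g' = σ.arr 16 0 ∧ σ.arr 6 g' = 0 →
        σ.real 2 (σ.arr 10 0) g' ≤ σ.real 2 (σ.arr 10 0) g := by
  refine (run_argmax (by decide) (by decide) (fun g => σ.arr 5 g = σ.arr 16 0 ∧ σ.arr 6 g = 0)
    (fun g => σ.real 2 (σ.arr 10 0) g) fun τ h1 h2 e => ?_).resolve_left fun h => ?_
  · simp only [Test.Holds, NatExp.eval, RealExp.eval, Store.nat_eq_arr, h2]
    rw [h1 5 (by decide) (by decide), h1 6 (by decide) (by decide), h1 10 (by decide) (by decide),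
      h1 16 (by decide) (by decide)]
    exact ⟨by omega, rfl⟩
  · obtain ⟨g, hg, hP⟩ := hex
    exact h.2 g hg hP

/-- Give the current good to the current agent. -/
def give : LoopProg :=
  .seq (setElem 6 (.sub (var 13) (const 1)) (.add (elem 7 (var 10)) (const 1))) <|
  .seq (setElem 8 (elem 7 (var 10)) (const 1)) <| .loop 20 0 0 <|
    setReal 3 (var 20) (elem 7 (var 10)) (.add (.get 3 (var 20) (elem 7 (var 10)))
      (.get 2 (var 20) (.sub (var 13) (const 1))))

theorem run_give {σ : Store} {g : ℕ} (hg : σ.arr 13 0 = g + 1) :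
    (give.run σ).arr 6 = Function.update (σ.arr 6) g (σ.arr 7 (σ.arr 10 0) + 1) ∧
      (give.run σ).arr 8 = Function.update (σ.arr 8) (σ.arr 7 (σ.arr 10 0)) 1 ∧
      ∀ i < σ.arr 0 0, ∀ b, (give.run σ).real 3 i b =
        if b = σ.arr 7 (σ.arr 10 0) then σ.real 3 i b + σ.real 2 i g else σ.real 3 i b := by
  have h : ∀ i b, (give.run σ).real 3 i b =
        if i < σ.arr 0 0 ∧ b = σ.arr 7 (σ.arr 10 0) then σ.real 3 i b + σ.real 2 i g
        else σ.real 3 i b := by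
    refine run_loop (fun k τ => ∀ i b, τ.real 3 i b =
        if i < k ∧ b = σ.arr 7 (σ.arr 10 0) then σ.real 3 i b + σ.real 2 i g
        else σ.real 3 i b) (σ.arr 0 0) ?_ ?_ ?_
    · simp [NatExp.eval, Store.nat_eq_arr, Store.arr_setNat]
    · simp
    · intro k τ hk hc hfr hinv i b
      rw [Store.nat_eq_arr] at hc
      have e7 : τ.arr 7 = σ.arr 7 := by rw [hfr.arr 7 rfl, run_arr _ _ 7 rfl, run_arr _ _ 7 rfl]
      have e10 : τ.arr 10 = σ.arr 10 := by
        rw [hfr.arr 10 rfl, run_arr _ _ 10 rfl, run_arr _ _ 10 rfl]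
      have e13 : τ.arr 13 = σ.arr 13 := by
        rw [hfr.arr 13 rfl, run_arr _ _ 13 rfl, run_arr _ _ 13 rfl]
      have e2 : τ.real 2 = σ.real 2 := by
        rw [hfr.2 2 rfl, run_real _ _ 2 rfl, run_real _ _ 2 rfl]
      simp only [run_setReal, NatExp.eval, RealExp.eval, Store.nat_eq_arr, Store.setNat_real,
        Store.real_setReal, if_true, hc, e7, e10, e13, e2, hg, Nat.add_sub_cancel, hinv]
      by_cases hb : b = σ.arr 7 (σ.arr 10 0)
      · rcases lt_trichotomy i k with hik | rfl | hik
        · simp [hb, hik.ne, hik, show i < k + 1 by omega]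
        · simp [hb]
        · simp [hb, hik.ne', show ¬ i < k by omega, show ¬ i < k + 1 by omega]
      · simp [hb]
  refine ⟨?_, ?_, fun i hi b => ?_⟩
  · simp only [give, run_seq]
    rw [run_arr _ _ 6 rfl]
    simp [NatExp.eval, Store.nat_eq_arr, Store.arr_setNat, hg]
  · simp only [give, run_seq]
    rw [run_arr _ _ 8 rfl]
    simp [NatExp.eval, Store.nat_eq_arr, Store.arr_setNat]
  · rw [h]; simp [hi]

/-- One pick. -/
def round : LoopProg := .seq start (.seq search (.seq choose give))

theorem run_round {σ : Store} {n N a r : ℕ} {lb : ℝ} (hn : σ.arr 0 0 = n) (hN : σ.arr 2 0 = N)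
    (hQ : n * n < σ.arr 3 0) (h4 : σ.arr 4 0 = a + 1) (ha : a < n)
    (hu : ∀ i g, 0 ≤ σ.real 2 i g) (hr : r < n)
    (hκ : ((Finset.range N).filter fun g => σ.arr 5 g = σ.arr 16 0).card = n)
    (h : PickState n N (σ.real 2) (σ.arr 5) (σ.arr 15) (σ.arr 16 0) a lb r (σ.arr 6) (σ.arr 8)
      (σ.real 3) (σ.arr 7)) :
    PickState n N (σ.real 2) (σ.arr 5) (σ.arr 15) (σ.arr 16 0) a lb (r + 1)
      ((round.run σ).arr 6) ((round.run σ).arr 8) ((round.run σ).real 3) ((round.run σ).arr 7) := by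
  subst hn hN
  simp only [round, run_seq]
  obtain ⟨s1, s2, s3⟩ := run_start h4 ha (h.exists_free hr)
  set σ₁ := start.run σ with hσ₁
  have a0 : σ₁.arr 0 = σ.arr 0 := run_arr _ _ 0 rfl
  have a2 : σ₁.arr 2 = σ.arr 2 := run_arr _ _ 2 rfl
  have a3 : σ₁.arr 3 = σ.arr 3 := run_arr _ _ 3 rfl
  have a7 : σ₁.arr 7 = σ.arr 7 := run_arr _ _ 7 rfl
  have a8 : σ₁.arr 8 = σ.arr 8 := run_arr _ _ 8 rfl
  have aW : σ₁.real 3 = σ.real 3 := run_real _ _ 3 rfl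
  have hs := run_search (σ := σ₁)
  rw [a0, a7, a8, aW, a3] at hs
  have hs := hs h.isAssignment s1 s2
  set σ₂ := search.run σ₁ with hσ₂
  have b0 : σ₂.arr 0 = σ.arr 0 := (run_arr _ _ 0 rfl).trans a0
  have b2 : σ₂.arr 2 = σ.arr 2 := (run_arr _ _ 2 rfl).trans a2
  have b5 : σ₂.arr 5 = σ.arr 5 := (run_arr _ _ 5 rfl).trans (run_arr _ _ 5 rfl)
  have b6 : σ₂.arr 6 = σ.arr 6 := (run_arr _ _ 6 rfl).trans (run_arr _ _ 6 rfl)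
  have b8 : σ₂.arr 8 = σ.arr 8 := (run_arr _ _ 8 rfl).trans a8
  have b16 : σ₂.arr 16 = σ.arr 16 := (run_arr _ _ 16 rfl).trans (run_arr _ _ 16 rfl)
  have bu : σ₂.real 2 = σ.real 2 := (run_real _ _ 2 rfl).trans (run_real _ _ 2 rfl)
  have bW : σ₂.real 3 = σ.real 3 := (run_real _ _ 3 rfl).trans aW
  -- More than `n * n` rounds have been made, so the alternative with `envyRank` is impossible.
  have hsrc := hs.progress.resolve_right (by omega)
  have h' := h.reassign ha hs.reassigns
  have hc := run_choose (σ := σ₂)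
  rw [b2, b5, b6, b16, bu] at hc
  obtain ⟨g, hg, c1, c2, c3⟩ := hc (h'.exists_good hr hκ)
  set σ₃ := choose.run σ₂ with hσ₃
  obtain ⟨d1, d2, d3⟩ := run_give c1
  have c0 : σ₃.arr 0 = σ.arr 0 := (run_arr _ _ 0 rfl).trans b0
  have c6 : σ₃.arr 6 = σ.arr 6 := (run_arr _ _ 6 rfl).trans b6
  have c7 : σ₃.arr 7 = σ₂.arr 7 := run_arr _ _ 7 rfl
  have c8 : σ₃.arr 8 = σ.arr 8 := (run_arr _ _ 8 rfl).trans b8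
  have c10 : σ₃.arr 10 = σ₂.arr 10 := run_arr _ _ 10 rfl
  have cu : σ₃.real 2 = σ.real 2 := (run_real _ _ 2 rfl).trans bu
  have cW : σ₃.real 3 = σ.real 3 := (run_real _ _ 3 rfl).trans bW
  rw [c6, c7, c10] at d1
  rw [c8, c7, c10] at d2
  rw [c0, c7, c10, cu, cW] at d3
  have d7 : (give.run σ₃).arr 7 = σ₂.arr 7 := (run_arr _ _ 7 rfl).trans c7
  rw [d1, d2, d7]
  refine (h'.pick hu hs.lt hs.free hsrc hg c2.1 c2.2 (fun g' hg' h1 h2 => c3 g' hg' ⟨h1, h2⟩)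
    fun hr0 hW => ?_).congr ha d3
  have hgot : ∀ b < σ.arr 0 0, σ.arr 8 b = 0 := by
    intro b hb
    have hcard := h.card_got
    rw [hr0, Finset.card_eq_zero, Finset.filter_eq_empty_iff] at hcard
    simpa using hcard (Finset.mem_range.2 hb)
  have hxa := s3 (hgot _ (h.isAssignment.1 a ha))
  -- When all bundles are worthless nobody envies anybody, so the search leaves its starting agent
  -- `a` in place.
  rw [(hs.source fun j hj _ => ?_).1, hxa]
  rw [hW j hj _ (h.isAssignment.1 _ s1), hW j hj _ (h.isAssignment.1 j hj)]

/-- Hand out the current block, unless this has been done before. -/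
def handOut : LoopProg :=
  .ite (natLe (elem 15 (var 16)) (const 0))
    (.seq (.loop 23 0 0 (setElem 8 (var 23) (const 0))) <|
      .seq (.loop 23 0 0 round) (setElem 15 (var 16) (const 1))) .skip

theorem run_handOut {σ : Store} {n N a : ℕ} {lb : ℝ} (hn : σ.arr 0 0 = n) (hN : σ.arr 2 0 = N)
    (hQ : n * n < σ.arr 3 0) (h4 : σ.arr 4 0 = a + 1) (ha : a < n)
    (hu : ∀ i g, 0 ≤ σ.real 2 i g)
    (hκ : ((Finset.range N).filter fun g => σ.arr 5 g = σ.arr 16 0).card = n)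
    (h : BlockState n N (σ.real 2) (σ.arr 5) (σ.arr 15) (σ.arr 6) (σ.real 3) (σ.arr 7))
    (hlb : lb ≤ σ.real 3 a (σ.arr 7 a) ∨ (σ.arr 15 (σ.arr 16 0) = 0 ∧
      (∀ i < n, ∀ b < n, σ.real 3 i b = 0) ∧
        ∃ g < N, σ.arr 5 g = σ.arr 16 0 ∧ lb ≤ σ.real 2 a g)) :
    BlockState n N (σ.real 2) (σ.arr 5) ((handOut.run σ).arr 15) ((handOut.run σ).arr 6)
        ((handOut.run σ).real 3) ((handOut.run σ).arr 7) ∧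
      lb ≤ (handOut.run σ).real 3 a ((handOut.run σ).arr 7 a) ∧
      (handOut.run σ).arr 15 (σ.arr 16 0) ≠ 0 ∧
      ∀ k, σ.arr 15 k ≠ 0 → (handOut.run σ).arr 15 k ≠ 0 := by
  by_cases hd : σ.arr 15 (σ.arr 16 0) = 0
  swap
  · rw [handOut, run_ite_neg (by
      simp only [Test.Holds, NatExp.eval, Store.nat_eq_arr]; omega)]
    simp only [run_skip]
    exact ⟨h, hlb.resolve_right fun h => hd h.1, hd, fun _ h => h⟩
  rw [handOut, run_ite_pos (by simp only [Test.Holds, NatExp.eval, Store.nat_eq_arr]; omega)]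
  simp only [run_seq]
  have hgot : ∀ b < n, ((loop 23 0 0 (setElem 8 (var 23) (const 0))).run σ).arr 8 b = 0 := by
    refine run_loop (fun k τ => ∀ b < k, τ.arr 8 b = 0) n hn (fun b hb => absurd hb (by omega)) ?_
    intro k τ hk hc hfr hinv b hb
    rw [Store.nat_eq_arr] at hc
    simp only [run_setNat, NatExp.eval, Store.nat_eq_arr, hc, Store.arr_setNat,
      show (8 : ℕ) ≠ 23 by decide, if_false, if_true, Function.update_apply]
    split_ifs
    · rfl
    · exact hinv b (by omega)
  set σ₁ := (loop 23 0 0 (setElem 8 (var 23) (const 0))).run σ with hσ₁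
  have a0 : σ₁.arr 0 = σ.arr 0 := run_arr _ _ 0 rfl
  have a2 : σ₁.arr 2 = σ.arr 2 := run_arr _ _ 2 rfl
  have a3 : σ₁.arr 3 = σ.arr 3 := run_arr _ _ 3 rfl
  have a4 : σ₁.arr 4 = σ.arr 4 := run_arr _ _ 4 rfl
  have a5 : σ₁.arr 5 = σ.arr 5 := run_arr _ _ 5 rfl
  have a6 : σ₁.arr 6 = σ.arr 6 := run_arr _ _ 6 rfl
  have a7 : σ₁.arr 7 = σ.arr 7 := run_arr _ _ 7 rfl
  have a15 : σ₁.arr 15 = σ.arr 15 := run_arr _ _ 15 rfl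
  have a16 : σ₁.arr 16 = σ.arr 16 := run_arr _ _ 16 rfl
  have au : σ₁.real 2 = σ.real 2 := run_real _ _ 2 rfl
  have aW : σ₁.real 3 = σ.real 3 := run_real _ _ 3 rfl
  have hpick : PickState n N (σ.real 2) (σ.arr 5) (σ.arr 15) (σ.arr 16 0) a lb n
      (((loop 23 0 0 round).run σ₁).arr 6) (((loop 23 0 0 round).run σ₁).arr 8)
      (((loop 23 0 0 round).run σ₁).real 3) (((loop 23 0 0 round).run σ₁).arr 7) := by
    refine run_loop (fun k τ => PickState n N (σ.real 2) (σ.arr 5) (σ.arr 15) (σ.arr 16 0) a lb k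
      (τ.arr 6) (τ.arr 8) (τ.real 3) (τ.arr 7)) n (by rw [Store.nat_eq_arr, a0, hn]) ?_ ?_
    · simp only [Store.arr_setNat, show (6 : ℕ) ≠ 23 by decide, show (7 : ℕ) ≠ 23 by decide,
        show (8 : ℕ) ≠ 23 by decide, if_false, Store.setNat_real, a6, a7, aW]
      exact h.pickState hd hgot (hlb.imp_right fun h => h.2)
    · intro k τ hk hc hfr hinv
      have e0 : τ.arr 0 = σ.arr 0 := (hfr.arr 0 rfl).trans a0
      have e2 : τ.arr 2 = σ.arr 2 := (hfr.arr 2 rfl).trans a2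
      have e3 : τ.arr 3 = σ.arr 3 := (hfr.arr 3 rfl).trans a3
      have e4 : τ.arr 4 = σ.arr 4 := (hfr.arr 4 rfl).trans a4
      have e5 : τ.arr 5 = σ.arr 5 := (hfr.arr 5 rfl).trans a5
      have e15 : τ.arr 15 = σ.arr 15 := (hfr.arr 15 rfl).trans a15
      have e16 : τ.arr 16 = σ.arr 16 := (hfr.arr 16 rfl).trans a16
      have eu : τ.real 2 = σ.real 2 := (hfr.2 2 rfl).trans au
      have hr := run_round (σ := τ) (n := n) (N := N) (a := a) (r := k) (lb := lb)
      rw [e0, e2, e3, e4, e5, e15, e16, eu] at hr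
      simp only [Store.arr_setNat, show (6 : ℕ) ≠ 23 by decide, show (7 : ℕ) ≠ 23 by decide,
        show (8 : ℕ) ≠ 23 by decide, if_false, Store.setNat_real]
      exact hr hn hN hQ h4 ha hu hk hκ hinv
  set σ₂ := (loop 23 0 0 round).run σ₁ with hσ₂
  have b15 : σ₂.arr 15 = σ.arr 15 := (run_arr _ _ 15 rfl).trans a15
  have b16 : σ₂.arr 16 = σ.arr 16 := (run_arr _ _ 16 rfl).trans a16
  simp only [run_setNat, NatExp.eval, Store.nat_eq_arr, Store.arr_setNat, b15, b16,
    show (6 : ℕ) ≠ 15 by decide, show (7 : ℕ) ≠ 15 by decide, if_false, if_true,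
    Store.setNat_real]
  obtain ⟨h1, h2⟩ := hpick.blockState (by omega) hκ
    (done' := Function.update (σ.arr 15) (σ.arr 16 0) 1) (by simp)
    fun k hk => Function.update_of_ne hk _ _
  refine ⟨h1, h2, by simp, fun k hk => ?_⟩
  rw [Function.update_apply]
  split_ifs
  · simp
  · exact hk

end LoopProg

/-! ### Sorting the goods into blocks -/

/-- The state of the division into blocks after `k` complete blocks and `r` further goods. -/
structure LabelState (n N : ℕ) (v : ℕ → ℝ) (k r : ℕ) (blk : ℕ → ℕ) : Prop where
  le : ∀ g < N, blk g ≤ k + 1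
  card : ∀ κ, 1 ≤ κ → κ ≤ k → ((Finset.range N).filter fun g => blk g = κ).card = n
  card_last : ((Finset.range N).filter fun g => blk g = k + 1).card = r
  card_all : ((Finset.range N).filter fun g => blk g ≠ 0).card = k * n + r
  anti : ∀ g < N, ∀ g' < N, blk g ≠ 0 → (blk g' = 0 ∨ blk g < blk g') → v g' ≤ v g

namespace LabelState

variable {n N : ℕ} {v : ℕ → ℝ} {k r : ℕ} {blk : ℕ → ℕ}

theorem init (h : ∀ g, blk g = 0) : LabelState n N v 0 0 blk :=
  ⟨fun g _ => by simp [h], fun κ _ _ => by omega, by simp [h], by simp [h],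
    fun g _ g' _ h' => absurd (h g) h'⟩

theorem exists_unlabelled (h : LabelState n N v k r blk) (hN : k * n + r < N) :
    ∃ g < N, blk g = 0 := by
  by_contra! hb
  have := h.card_all
  rw [Finset.filter_true_of_mem fun g hg => hb g (by simpa using hg), Finset.card_range] at this
  omega

/-- The label `0` stands for a good not yet placed and ranks behind all blocks in `anti`. Labelling
a most valuable such good preserves the order. -/
theorem step (h : LabelState n N v k r blk) {g₀ : ℕ} (hg₀ : g₀ < N) (h0 : blk g₀ = 0)
    (hmax : ∀ g < N, blk g = 0 → v g ≤ v g₀) :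
    LabelState n N v k (r + 1) (Function.update blk g₀ (k + 1)) := by
  constructor
  · intro g hg
    rw [Function.update_apply]
    split_ifs
    · exact le_rfl
    · exact h.le g hg
  · intro κ h1 hk
    rw [← h.card κ h1 hk]
    congr 1
    refine Finset.filter_congr fun g _ => ?_
    rw [Function.update_apply]
    split_ifs with hg
    · subst hg; omega
    · rfl
  · have : ((Finset.range N).filter fun g => Function.update blk g₀ (k + 1) g = k + 1) =
        insert g₀ ((Finset.range N).filter fun g => blk g = k + 1) := by
      ext g
      simp only [Finset.mem_filter, Finset.mem_range, Finset.mem_insert, Function.update_apply]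
      split_ifs with hg
      · simp [hg, hg₀]
      · simp [hg]
    rw [this, Finset.card_insert_of_notMem (by simp [h0]), h.card_last]
  · have : ((Finset.range N).filter fun g => Function.update blk g₀ (k + 1) g ≠ 0) =
        insert g₀ ((Finset.range N).filter fun g => blk g ≠ 0) := by
      ext g
      simp only [Finset.mem_filter, Finset.mem_range, Finset.mem_insert, Function.update_apply]
      split_ifs with hg
      · simp [hg, hg₀]
      · simp [hg]
    rw [this, Finset.card_insert_of_notMem (by simp [h0]), h.card_all, add_assoc]
  · intro g hg g' hg' hne hlt
    have hle' := h.le g' hg'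
    rw [Function.update_apply] at hne
    simp only [Function.update_apply] at hlt
    split_ifs at hne hlt with h1 h2 h2
    · rw [h1, h2]
    · subst h1
      exact hmax g' hg' (hlt.resolve_right (by omega))
    · subst h2
      exact h.anti g hg _ hg' hne (Or.inl h0)
    · exact h.anti g hg g' hg' hne hlt

theorem next (h : LabelState n N v k n blk) : LabelState n N v (k + 1) 0 blk where
  le g hg := (h.le g hg).trans (by omega)
  card κ h1 hk := by
    rcases Nat.lt_or_ge κ (k + 1) with hk' | hk'
    · exact h.card κ h1 (by omega)
    · rw [show κ = k + 1 by omega, h.card_last]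
  card_last := by
    rw [Finset.card_eq_zero, Finset.filter_eq_empty_iff]
    intro g hg
    have := h.le g (by simpa using hg)
    omega
  card_all := by rw [h.card_all]; ring
  anti := h.anti

theorem isBlocking {m : ℕ} (h : LabelState n (n * m) v m 0 blk) :
    IsBlocking n m (n * m) v blk := by
  have hpos : ∀ g < n * m, blk g ≠ 0 := by
    have hsub := Finset.filter_subset (fun g => blk g ≠ 0) (Finset.range (n * m))
    have := Finset.eq_of_subset_of_card_le hsub (by
      rw [h.card_all, Finset.card_range, add_zero, mul_comm])
    intro g hg
    have hmem := Finset.mem_range.2 hg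
    rw [← this] at hmem
    exact (Finset.mem_filter.1 hmem).2
  refine ⟨fun g hg => Nat.one_le_iff_ne_zero.2 (hpos g hg), fun g hg => ?_, h.card,
    fun g hg g' hg' hlt => h.anti g hg g' hg' (hpos g hg) (Or.inr hlt)⟩
  have h1 := h.le g hg
  have h2 := h.card_last
  rw [Finset.card_eq_zero, Finset.filter_eq_empty_iff] at h2
  have := h2 (Finset.mem_range.2 hg)
  omega

end LabelState

/-! ### Programs for the preparation, the distribution and the output -/

namespace LoopProg

open NatExp Test

/-- Compute the number of goods after padding, and the number of rounds of the search. -/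
def sizes : LoopProg :=
  .seq (.loop 20 0 0 (.loop 21 0 1 (setVar 2 (.add (var 2) (const 1))))) <|
  .seq (.loop 20 0 0 (.loop 21 0 0 (setVar 3 (.add (var 3) (const 1)))))
    (setVar 3 (.add (var 3) (const 1)))

/-- The machine cannot multiply, so products are obtained by counting in nested loops. The whole
array is described since the bounds for the running time concern all its entries. -/
theorem run_count {σ : Store} {r i : ℕ} (h0 : r ≠ 0) (h20 : r ≠ 20) (h21 : r ≠ 21)
    (hr : σ.arr r 0 = 0) :
    ((loop 20 0 0 (.loop 21 0 i (setVar r (.add (var r) (const 1))))).run σ).arr r =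
      Function.update (σ.arr r) 0 (σ.arr 0 0 * σ.arr 0 i) := by
  refine run_loop (fun k τ => τ.arr r = Function.update (σ.arr r) 0 (k * σ.arr 0 i)) (σ.arr 0 0)
    rfl ?_ ?_
  · have : Function.update (σ.arr r) 0 0 = σ.arr r := by
      funext j
      rw [Function.update_apply]
      split_ifs with hj
      exacts [by rw [hj, hr], rfl]
    rw [zero_mul, this]
    simp [Store.arr_setNat, h20]
  · intro k τ hk hc hfr hinv
    simp only [Store.arr_setNat, if_neg h20]
    refine run_loop (fun j υ => υ.arr r = Function.update (σ.arr r) 0 (k * σ.arr 0 i + j))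
      (σ.arr 0 i) ?_ ?_ ?_ |>.trans ?_
    · rw [Store.nat_eq_arr, hfr.arr 0 (by simp [writesNat, h0])]
    · simp [Store.arr_setNat, h21, hinv]
    · intro j υ hj hcj hfr' hinv'
      simp [NatExp.eval, Store.nat_eq_arr, Store.arr_setNat, h21, hinv', add_assoc]
    · rw [Nat.succ_mul]

theorem run_sizes {σ : Store} (h2 : σ.arr 2 0 = 0) (h3 : σ.arr 3 0 = 0) :
    (sizes.run σ).arr 2 = Function.update (σ.arr 2) 0 (σ.arr 0 0 * σ.arr 0 1) ∧
      (sizes.run σ).arr 3 = Function.update (σ.arr 3) 0 (σ.arr 0 0 * σ.arr 0 0 + 1) := by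
  simp only [sizes, run_seq]
  set σ₁ := (loop 20 0 0 (.loop 21 0 1 (setVar 2 (.add (var 2) (const 1))))).run σ with hσ₁
  have a2 : σ₁.arr 2 = Function.update (σ.arr 2) 0 (σ.arr 0 0 * σ.arr 0 1) :=
    run_count (by decide) (by decide) (by decide) h2
  have a0 : σ₁.arr 0 = σ.arr 0 := run_arr _ _ 0 rfl
  have a3 : σ₁.arr 3 = σ.arr 3 := run_arr _ _ 3 rfl
  have b3 := run_count (σ := σ₁) (r := 3) (i := 0) (by decide) (by decide) (by decide) (by
    rw [a3, h3])
  rw [a0, a3] at b3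
  constructor
  · rw [run_arr _ _ 2 rfl, run_arr _ _ 2 rfl, a2]
  · simp [NatExp.eval, Store.nat_eq_arr, Store.arr_setNat, b3]

/-- Choose the agent with the greatest total impact. -/
def favour : LoopProg :=
  .seq (.loop 20 0 0 (.loop 21 0 1 (setReal 4 (var 20) (const 0)
    (.add (.get 4 (var 20) (const 0)) (.get 1 (var 20) (var 21)))))) <|
  argmax 20 0 0 4 (fun _ => natLe (const 0) (const 0)) fun e => .get 4 e (const 0)

theorem run_favour {σ : Store} (hn : σ.arr 0 0 ≠ 0) (h4 : ∀ i j, σ.real 4 i j = 0) :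
    ∃ a < σ.arr 0 0, (favour.run σ).arr 4 0 = a + 1 ∧ ∀ i < σ.arr 0 0,
      ∑ g ∈ Finset.range (σ.arr 0 1), σ.real 1 i g ≤
        ∑ g ∈ Finset.range (σ.arr 0 1), σ.real 1 a g := by
  simp only [favour, run_seq]
  set p : LoopProg := .loop 20 0 0 (.loop 21 0 1 (setReal 4 (var 20) (const 0)
    (.add (.get 4 (var 20) (const 0)) (.get 1 (var 20) (var 21))))) with hp
  have h : ∀ i < σ.arr 0 0, (p.run σ).real 4 i 0 =
      ∑ g ∈ Finset.range (σ.arr 0 1), σ.real 1 i g := by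
    have := run_loop (c := 20) (a := 0) (i := 0) (p := .loop 21 0 1 (setReal 4 (var 20) (const 0)
        (.add (.get 4 (var 20) (const 0)) (.get 1 (var 20) (var 21))))) (σ := σ)
      (fun k τ => ∀ i, τ.real 4 i 0 =
        if i < k then ∑ g ∈ Finset.range (σ.arr 0 1), σ.real 1 i g else 0) (σ.arr 0 0) rfl
      (fun i => by simp [h4]) ?_
    · intro i hi
      rw [hp, this, if_pos hi]
    · intro k τ hk hc hfr hinv i
      rw [Store.nat_eq_arr] at hc
      simp only [Store.setNat_real]
      refine (run_loop (fun j υ => ∀ i, υ.real 4 i 0 = if i < k then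
        ∑ g ∈ Finset.range (σ.arr 0 1), σ.real 1 i g else if i = k then
          ∑ g ∈ Finset.range j, σ.real 1 i g else 0) (σ.arr 0 1) ?_ ?_ ?_ i).trans ?_
      · rw [Store.nat_eq_arr, hfr.arr 0 rfl]
      · intro i
        simp [hinv]
      · intro j υ hj hcj hfr' hinv' i
        rw [Store.nat_eq_arr] at hcj
        have e20 : υ.arr 20 0 = k := by rw [hfr'.arr 20 rfl, hc]
        have e1 : υ.real 1 = σ.real 1 := (hfr'.2 1 rfl).trans (hfr.2 1 rfl)
        simp only [run_setReal, NatExp.eval, RealExp.eval, Store.nat_eq_arr, Store.setNat_real,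
          Store.real_setReal, if_true, hcj, e20, e1, hinv', and_true]
        rcases lt_trichotomy i k with hik | rfl | hik
        · simp [hik, hik.ne]
        · simp [Finset.sum_range_succ]
        · simp [hik.ne', show ¬ i < k by omega]
      · rcases lt_trichotomy i k with hik | rfl | hik
        · simp [hik, show i < k + 1 by omega]
        · simp
        · simp [hik.ne', show ¬ i < k by omega, show ¬ i < k + 1 by omega]
  have b0 : (p.run σ).arr 0 = σ.arr 0 := run_arr p σ 0 rfl
  rcases run_argmax (c := 20) (a := 0) (i := 0) (r := 4) (σ := p.run σ)
    (cond := fun _ => natLe (const 0) (const 0)) (score := fun e => .get 4 e (const 0))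
    (by decide) (by decide) (fun _ => True) (fun i => (p.run σ).real 4 i 0) (fun τ h1 h2 e => by
      simp [Test.Holds, RealExp.eval, NatExp.eval, h2]) with ⟨-, h2⟩ | ⟨a, ha, h1, -, h2⟩
  · rw [b0] at h2
    exact absurd trivial (h2 0 (by omega))
  · rw [b0] at ha h2
    refine ⟨a, ha, h1, fun i hi => ?_⟩
    rw [← h i hi, ← h a ha]
    exact h2 i hi trivial

/-- The values that guide the picks: the favoured agent goes by impact. -/
def utilities : LoopProg :=
  .loop 20 0 0 <| .loop 21 0 1 <| .ite (natEq (var 20) (.sub (var 4) (const 1)))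
    (setReal 2 (var 20) (var 21) (.get 1 (var 20) (var 21)))
    (setReal 2 (var 20) (var 21) (.get 0 (var 20) (var 21)))

theorem run_utilities {σ : Store} {a : ℕ} (h4 : σ.arr 4 0 = a + 1)
    (h2 : ∀ i g, σ.real 2 i g = 0)
    (h01 : ∀ b i g, σ.arr 0 0 ≤ i ∨ σ.arr 0 1 ≤ g → b ≤ 1 → σ.real b i g = 0) (i g : ℕ) :
    (utilities.run σ).real 2 i g = if i = a then σ.real 1 i g else σ.real 0 i g := by
  -- The loops fill only the rectangle of real agents and goods. Outside it the table keeps its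
  -- initial `0`, which is also the input there.
  have h : (utilities.run σ).real 2 i g = if i < σ.arr 0 0 ∧ g < σ.arr 0 1 then
      (if i = a then σ.real 1 i g else σ.real 0 i g) else 0 := by
    refine run_loop (fun k τ => ∀ i g, τ.real 2 i g = if i < k ∧ g < σ.arr 0 1 then
      (if i = a then σ.real 1 i g else σ.real 0 i g) else 0) (σ.arr 0 0) rfl (by simp [h2]) ?_ i g
    intro k τ hk hc hfr hinv i g
    rw [Store.nat_eq_arr] at hc
    simp only [Store.setNat_real]
    refine (run_loop (fun j υ => ∀ i g, υ.real 2 i g =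
        if i < k ∧ g < σ.arr 0 1 ∨ i = k ∧ g < j then
        (if i = a then σ.real 1 i g else σ.real 0 i g) else 0) (σ.arr 0 1) ?_ ?_ ?_ i g).trans ?_
    · rw [Store.nat_eq_arr, hfr.arr 0 rfl]
    · intro i
      simp [hinv]
    · intro j υ hj hcj hfr' hinv' i g
      rw [Store.nat_eq_arr] at hcj
      have e20 : υ.arr 20 0 = k := by rw [hfr'.arr 20 rfl, hc]
      have e4 : υ.arr 4 = σ.arr 4 := (hfr'.arr 4 rfl).trans (hfr.arr 4 rfl)
      have e1 : υ.real 1 = σ.real 1 := (hfr'.2 1 rfl).trans (hfr.2 1 rfl)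
      have e0 : υ.real 0 = σ.real 0 := (hfr'.2 0 rfl).trans (hfr.2 0 rfl)
      have hval : ∀ x : ℝ, (υ.setReal 2 k j x).real 2 i g =
          if i = k ∧ g = j then x else υ.real 2 i g := by
        intro x; simp [Store.real_setReal]
      have hfin : (if i = k ∧ g = j then (if k = a then σ.real 1 k j else σ.real 0 k j)
          else υ.real 2 i g) = if i < k ∧ g < σ.arr 0 1 ∨ i = k ∧ g < j + 1 then
            (if i = a then σ.real 1 i g else σ.real 0 i g) else 0 := by
        by_cases hij : i = k ∧ g = j
        · obtain ⟨rfl, rfl⟩ := hij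
          simp
        · rw [if_neg hij, hinv']
          refine if_congr ?_ rfl rfl
          omega
      by_cases hka : k = a
      · rw [run_ite_pos (by
          simp only [Test.Holds, NatExp.eval, Store.nat_eq_arr, e20, e4, h4]; omega)]
        simp only [run_setReal, NatExp.eval, RealExp.eval, Store.nat_eq_arr, Store.setNat_real,
          hcj, e20, e1, hval]
        rw [← hfin, if_pos hka]
      · rw [run_ite_neg (by
          simp only [Test.Holds, NatExp.eval, Store.nat_eq_arr, e20, e4, h4]; omega)]
        simp only [run_setReal, NatExp.eval, RealExp.eval, Store.nat_eq_arr, Store.setNat_real,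
          hcj, e20, e0, hval]
        rw [← hfin, if_neg hka]
    · refine if_congr ?_ rfl rfl
      omega
  rw [h]
  split_ifs with h1 h2 h2
  · rfl
  · rfl
  · exact (h01 1 i g (by omega) le_rfl).symm
  · exact (h01 0 i g (by omega) (by omega)).symm

/-- Divide the goods into blocks. -/
def label : LoopProg :=
  .loop 24 0 1 <| .loop 23 0 0 <|
    .seq (argmax 20 2 0 13 (fun e => natLe (elem 5 e) (const 0))
      fun e => .get 0 (.sub (var 4) (const 1)) e)
    (setElem 5 (.sub (var 13) (const 1)) (.add (var 24) (const 1)))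

theorem run_label {σ : Store} {n m a : ℕ} (hn : σ.arr 0 0 = n) (hm : σ.arr 0 1 = m)
    (hN : σ.arr 2 0 = n * m) (h4 : σ.arr 4 0 = a + 1) (h5 : ∀ g, σ.arr 5 g = 0) :
    IsBlocking n m (n * m) (σ.real 0 a) ((label.run σ).arr 5) := by
  refine LabelState.isBlocking ?_
  refine run_loop (fun k τ => LabelState n (n * m) (σ.real 0 a) k 0 (τ.arr 5)) m hm ?_ ?_
  · exact LabelState.init (by simpa [Store.arr_setNat] using h5)
  intro k τ hk hc hfr hinv
  rw [Store.nat_eq_arr] at hc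
  simp only [Store.arr_setNat, show (5 : ℕ) ≠ 24 by decide, if_false]
  refine LabelState.next ?_
  refine run_loop (fun r υ => LabelState n (n * m) (σ.real 0 a) k r (υ.arr 5)) n ?_ ?_ ?_
  · rw [Store.nat_eq_arr, hfr.arr 0 rfl, hn]
  · simpa [Store.arr_setNat] using hinv
  intro r υ hr hcr hfr' hinv'
  have e2 : υ.arr 2 0 = n * m := by rw [hfr'.arr 2 rfl, hfr.arr 2 rfl, hN]
  have e4 : υ.arr 4 0 = a + 1 := by rw [hfr'.arr 4 rfl, hfr.arr 4 rfl, h4]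
  have e24 : υ.arr 24 0 = k := by rw [hfr'.arr 24 rfl, hc]
  have e0 : υ.real 0 = σ.real 0 := by rw [hfr'.2 0 rfl, hfr.2 0 rfl]
  have hex : ∃ g < n * m, υ.arr 5 g = 0 := by
    refine hinv'.exists_unlabelled ?_
    -- Fewer than `n * m` goods are labelled so far, so the maximum is over a nonempty set.
    calc k * n + r < k * n + n := by omega
      _ = (k + 1) * n := by ring
      _ ≤ m * n := Nat.mul_le_mul_right n hk
      _ = n * m := mul_comm _ _
  have harg := (run_argmax (c := 20) (a := 2) (i := 0) (r := 13) (σ := υ)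
    (cond := fun e => natLe (elem 5 e) (const 0))
    (score := fun e => .get 0 (.sub (var 4) (const 1)) e)
    (by decide) (by decide) (fun g => υ.arr 5 g = 0) (σ.real 0 a) fun τ' h1 h2 e => by
      simp only [Test.Holds, RealExp.eval, NatExp.eval, Store.nat_eq_arr, h2, e0,
        h1 5 (by decide) (by decide), h1 4 (by decide) (by decide), e4, Nat.add_sub_cancel]
      exact ⟨by omega, trivial⟩).resolve_left fun h => by
        obtain ⟨g, hg, h0⟩ := hex
        exact h.2 g (by rwa [e2]) h0
  rw [e2] at harg
  obtain ⟨g, hg, h13, h0, hmax⟩ := harg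
  simp only [run_seq, run_setNat, NatExp.eval, Store.nat_eq_arr, h13, Store.arr_setNat,
    show (5 : ℕ) ≠ 23 by decide, if_false, if_true, Nat.add_sub_cancel]
  rw [run_arr _ υ 5 rfl, run_arr _ υ 24 rfl, e24]
  exact hinv'.step hg h0 hmax

/-- Find the good of the greatest impact for the favoured agent. -/
def findBest : LoopProg :=
  argmax 20 2 0 14 (fun _ => natLe (const 0) (const 0)) fun e => .get 2 (.sub (var 4) (const 1)) e

theorem run_findBest {σ : Store} {a : ℕ} (h4 : σ.arr 4 0 = a + 1) (hN : σ.arr 2 0 ≠ 0) :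
    ∃ g < σ.arr 2 0, (findBest.run σ).arr 14 0 = g + 1 ∧
      ∀ g' < σ.arr 2 0, σ.real 2 a g' ≤ σ.real 2 a g := by
  rcases run_argmax (c := 20) (a := 2) (i := 0) (r := 14) (σ := σ)
    (cond := fun _ => natLe (const 0) (const 0))
    (score := fun e => .get 2 (.sub (var 4) (const 1)) e)
    (by decide) (by decide) (fun _ => True) (σ.real 2 a) (fun τ h1 h2 e => by
      simp [Test.Holds, RealExp.eval, NatExp.eval, Store.nat_eq_arr, h2,
        h1 4 (by decide) (by decide), h4]) with ⟨-, h2⟩ | ⟨g, hg, h1, -, h2⟩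
  · exact absurd trivial (h2 0 (by omega))
  · exact ⟨g, hg, h1, fun g' hg' => h2 g' hg' trivial⟩

/-- Each agent holds the bundle of the same number. -/
def initBundles : LoopProg := .loop 20 0 0 (setElem 7 (var 20) (var 20))

theorem run_initBundles (σ : Store) : ∀ i < σ.arr 0 0, (initBundles.run σ).arr 7 i = i := by
  refine run_loop (fun k τ => ∀ i < k, τ.arr 7 i = i) (σ.arr 0 0) rfl
    (fun i hi => absurd hi (by omega)) ?_
  intro k τ hk hc hfr hinv i hi
  rw [Store.nat_eq_arr] at hc
  simp only [run_setNat, NatExp.eval, Store.nat_eq_arr, hc, Store.arr_setNat,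
    show (7 : ℕ) ≠ 20 by decide, if_false, if_true, Function.update_apply]
  split_ifs with h
  · exact h.symm
  · exact hinv i (by omega)

/-- Hand out all the blocks, beginning with that of the good of the greatest impact. -/
def handOutAll : LoopProg :=
  .seq (setVar 16 (elem 5 (.sub (var 14) (const 1)))) <| .seq handOut <|
    .loop 24 0 1 (.seq (setVar 16 (.add (var 24) (const 1))) handOut)

/-- The greatest impact enters as the bound `lb`. It is secured by the first block, handed out when
nothing has been given away, and carried along by the later ones; the loop over all blocks skips the
one already done. -/
theorem run_handOutAll {σ : Store} {n m a g : ℕ} (hn : σ.arr 0 0 = n) (hm : σ.arr 0 1 = m)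
    (hN : σ.arr 2 0 = n * m)
    (hQ : n * n < σ.arr 3 0) (h4 : σ.arr 4 0 = a + 1) (ha : a < n)
    (hu : ∀ i g, 0 ≤ σ.real 2 i g) {v : ℕ → ℝ} (hb : IsBlocking n m (n * m) v (σ.arr 5))
    (h14 : σ.arr 14 0 = g + 1) (hg : g < n * m)
    (h15 : ∀ k, σ.arr 15 k = 0) (h6 : ∀ g, σ.arr 6 g = 0) (hW : ∀ i b, σ.real 3 i b = 0)
    (h7 : ∀ i < n, σ.arr 7 i = i) :
    BundleState n (n * m) (σ.real 2) (σ.arr 5) ((handOutAll.run σ).arr 6)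
        ((handOutAll.run σ).real 3) ((handOutAll.run σ).arr 7) ∧
      (∀ g < n * m, (handOutAll.run σ).arr 6 g ≠ 0) ∧
      σ.real 2 a g ≤ (handOutAll.run σ).real 3 a ((handOutAll.run σ).arr 7 a) := by
  simp only [handOutAll, run_seq]
  set σ₁ := (setVar 16 (elem 5 (.sub (var 14) (const 1)))).run σ with hσ₁
  have a16 : σ₁.arr 16 0 = σ.arr 5 g := by
    simp [hσ₁, NatExp.eval, Store.nat_eq_arr, Store.arr_setNat, h14]
  have a0 : σ₁.arr 0 = σ.arr 0 := run_arr _ _ 0 rfl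
  have a2 : σ₁.arr 2 = σ.arr 2 := run_arr _ _ 2 rfl
  have a3 : σ₁.arr 3 = σ.arr 3 := run_arr _ _ 3 rfl
  have a4 : σ₁.arr 4 = σ.arr 4 := run_arr _ _ 4 rfl
  have a5 : σ₁.arr 5 = σ.arr 5 := run_arr _ _ 5 rfl
  have a6 : σ₁.arr 6 = σ.arr 6 := run_arr _ _ 6 rfl
  have a7 : σ₁.arr 7 = σ.arr 7 := run_arr _ _ 7 rfl
  have a15 : σ₁.arr 15 = σ.arr 15 := run_arr _ _ 15 rfl
  have au : σ₁.real 2 = σ.real 2 := run_real _ _ 2 rfl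
  have aW : σ₁.real 3 = σ.real 3 := run_real _ _ 3 rfl
  have hfirst := run_handOut (σ := σ₁) (n := n) (N := n * m) (a := a) (lb := σ.real 2 a g)
  rw [a0, a2, a3, a4, a5, a6, a7, a15, a16, au, aW] at hfirst
  obtain ⟨c1, c2, -, -⟩ := hfirst hn hN hQ h4 ha hu (hb.card _ (hb.pos g hg) (hb.le g hg))
    (.init h15 h6 hW h7) (Or.inr ⟨h15 _, fun i _ b _ => hW i b, g, hg, rfl, le_rfl⟩)
  set σ₂ := handOut.run σ₁ with hσ₂
  have b0 : σ₂.arr 0 = σ.arr 0 := (run_arr _ _ 0 rfl).trans a0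
  have b2 : σ₂.arr 2 = σ.arr 2 := (run_arr _ _ 2 rfl).trans a2
  have b3 : σ₂.arr 3 = σ.arr 3 := (run_arr _ _ 3 rfl).trans a3
  have b4 : σ₂.arr 4 = σ.arr 4 := (run_arr _ _ 4 rfl).trans a4
  have b5 : σ₂.arr 5 = σ.arr 5 := (run_arr _ _ 5 rfl).trans a5
  have bu : σ₂.real 2 = σ.real 2 := (run_real _ _ 2 rfl).trans au
  have h := run_loop (c := 24) (a := 0) (i := 1)
    (p := .seq (setVar 16 (.add (var 24) (const 1))) handOut) (σ := σ₂)
    (fun k τ => BlockState n (n * m) (σ.real 2) (σ.arr 5) (τ.arr 15) (τ.arr 6) (τ.real 3)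
        (τ.arr 7) ∧ σ.real 2 a g ≤ τ.real 3 a (τ.arr 7 a) ∧ ∀ κ, 1 ≤ κ → κ ≤ k → τ.arr 15 κ ≠ 0)
    m (by rw [Store.nat_eq_arr, b0, hm]) ?_ ?_
  · exact ⟨h.1.toBundleState, fun g hg => (h.1.done_iff g hg).2
      (h.2.2 _ (hb.pos g hg) (hb.le g hg)), h.2.1⟩
  · simp only [Store.arr_setNat, show (6 : ℕ) ≠ 24 by decide, show (7 : ℕ) ≠ 24 by decide,
      show (15 : ℕ) ≠ 24 by decide, if_false, Store.setNat_real]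
    exact ⟨c1, c2, fun κ h1 h2 => by omega⟩
  · rintro k τ hk hc hfr ⟨i1, i2, i3⟩
    rw [Store.nat_eq_arr] at hc
    simp only [run_seq]
    set τ₁ := (setVar 16 (.add (var 24) (const 1))).run τ with hτ₁
    have e16 : τ₁.arr 16 0 = k + 1 := by
      simp [hτ₁, NatExp.eval, Store.nat_eq_arr, Store.arr_setNat, hc]
    have e0 : τ₁.arr 0 = σ.arr 0 := (run_arr _ _ 0 rfl).trans ((hfr.arr 0 rfl).trans b0)
    have e2 : τ₁.arr 2 = σ.arr 2 := (run_arr _ _ 2 rfl).trans ((hfr.arr 2 rfl).trans b2)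
    have e3 : τ₁.arr 3 = σ.arr 3 := (run_arr _ _ 3 rfl).trans ((hfr.arr 3 rfl).trans b3)
    have e4 : τ₁.arr 4 = σ.arr 4 := (run_arr _ _ 4 rfl).trans ((hfr.arr 4 rfl).trans b4)
    have e5 : τ₁.arr 5 = σ.arr 5 := (run_arr _ _ 5 rfl).trans ((hfr.arr 5 rfl).trans b5)
    have eu : τ₁.real 2 = σ.real 2 := (run_real _ _ 2 rfl).trans ((hfr.2 2 rfl).trans bu)
    have e6 : τ₁.arr 6 = τ.arr 6 := run_arr _ _ 6 rfl
    have e7 : τ₁.arr 7 = τ.arr 7 := run_arr _ _ 7 rfl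
    have e15 : τ₁.arr 15 = τ.arr 15 := run_arr _ _ 15 rfl
    have eW : τ₁.real 3 = τ.real 3 := run_real _ _ 3 rfl
    have hnext := run_handOut (σ := τ₁) (n := n) (N := n * m) (a := a) (lb := σ.real 2 a g)
    rw [e0, e2, e3, e4, e5, e6, e7, e15, e16, eu, eW] at hnext
    obtain ⟨d1, d2, d3, d4⟩ := hnext hn hN hQ h4 ha hu (hb.card _ (by omega) (by omega)) i1
      (Or.inl i2)
    simp only [Store.arr_setNat, show (6 : ℕ) ≠ 24 by decide, show (7 : ℕ) ≠ 24 by decide,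
      show (15 : ℕ) ≠ 24 by decide, if_false, Store.setNat_real]
    refine ⟨d1, d2, fun κ h1 h2 => ?_⟩
    rcases Nat.lt_or_ge κ (k + 1) with hκ | hκ
    · exact d4 κ (i3 κ h1 (by omega))
    · rwa [show κ = k + 1 by omega]

/-- Write down who gets which good. -/
def writeOutput : LoopProg :=
  .loop 20 0 0 <| .loop 21 0 1 <|
    .ite (natEq (elem 6 (var 21)) (.add (elem 7 (var 20)) (const 1)))
      (setElem 1 (var 21) (var 20)) .skip

theorem run_writeOutput {σ : Store} (hB : IsAssignment (σ.arr 0 0) (σ.arr 7)) :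
    ∀ g < σ.arr 0 1, ∀ i < σ.arr 0 0, σ.arr 6 g = σ.arr 7 i + 1 →
      (writeOutput.run σ).arr 1 g = i := by
  suffices h : ∀ i < σ.arr 0 0, ∀ g < σ.arr 0 1, σ.arr 6 g = σ.arr 7 i + 1 →
      (writeOutput.run σ).arr 1 g = i from fun g hg i hi => h i hi g hg
  refine run_loop (fun k τ => ∀ i < k, ∀ g < σ.arr 0 1, σ.arr 6 g = σ.arr 7 i + 1 →
      τ.arr 1 g = i) (σ.arr 0 0) rfl (fun i hi => absurd hi (by omega)) ?_
  intro k τ hk hc hfr hinv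
  rw [Store.nat_eq_arr] at hc
  have h := run_loop (c := 21) (a := 0) (i := 1)
    (p := .ite (natEq (elem 6 (var 21)) (.add (elem 7 (var 20)) (const 1)))
      (setElem 1 (var 21) (var 20)) .skip) (σ := τ)
    (fun j υ => (∀ i < k, ∀ g < σ.arr 0 1, σ.arr 6 g = σ.arr 7 i + 1 → υ.arr 1 g = i) ∧
      ∀ g < j, σ.arr 6 g = σ.arr 7 k + 1 → υ.arr 1 g = k) (σ.arr 0 1)
    (by rw [Store.nat_eq_arr, hfr.arr 0 rfl])
    ⟨by simpa [Store.arr_setNat] using hinv, fun g hg => absurd hg (by omega)⟩ ?_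
  · intro i hi g hg hgi
    simp only [Store.arr_setNat, show (1 : ℕ) ≠ 20 by decide, if_false]
    rcases Nat.lt_succ_iff_lt_or_eq.1 hi with hi | rfl
    · exact h.1 i hi g hg hgi
    · exact h.2 g hg hgi
  · rintro j υ hj hcj hfr' ⟨i1, i2⟩
    rw [Store.nat_eq_arr] at hcj
    have e20 : υ.arr 20 0 = k := by rw [hfr'.arr 20 rfl, hc]
    have e6 : υ.arr 6 = σ.arr 6 := (hfr'.arr 6 rfl).trans (hfr.arr 6 rfl)
    have e7 : υ.arr 7 = σ.arr 7 := (hfr'.arr 7 rfl).trans (hfr.arr 7 rfl)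
    by_cases hjk : σ.arr 6 j = σ.arr 7 k + 1
    · rw [run_ite_pos (by
        simp only [Test.Holds, NatExp.eval, Store.nat_eq_arr, hcj, e20, e6, e7]; omega)]
      simp only [run_setNat, NatExp.eval, Store.nat_eq_arr, hcj, e20, Store.arr_setNat,
        show (1 : ℕ) ≠ 21 by decide, if_false, if_true, Function.update_apply]
      refine ⟨fun i hi g hg hgi => ?_, fun g hg hgi => ?_⟩
      · split_ifs with hgj
        · subst hgj
          -- An earlier entry is not overwritten by another agent, since different agents hold
          -- different bundles.
          exact hB.2 hk (hi.trans hk) (by omega)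
        · exact i1 i hi g hg hgi
      · split_ifs with hgj
        · rfl
        · exact i2 g (by omega) hgi
    · rw [run_ite_neg (by
        simp only [Test.Holds, NatExp.eval, Store.nat_eq_arr, hcj, e20, e6, e7]; omega)]
      simp only [run_skip, Store.arr_setNat, show (1 : ℕ) ≠ 21 by decide, if_false]
      refine ⟨i1, fun g hg hgi => ?_⟩
      rcases Nat.lt_succ_iff_lt_or_eq.1 hg with hg | rfl
      · exact i2 g hg hgi
      · exact absurd hgi hjk

/-- The algorithm after the computation of the sizes. -/
def allocate : LoopProg :=
  .seq favour <| .seq utilities <| .seq label <| .seq findBest <| .seq initBundles <|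
    .seq handOutAll writeOutput

theorem run_allocate {n m : ℕ} (I : FairDivision n m) (hn : 1 ≤ n) (hm : 1 ≤ m) {σ : Store}
    (h0 : σ.nat 0 = I.input.nat 0) (hN : σ.arr 2 0 = n * m) (hQ : n * n < σ.arr 3 0)
    (hz : ∀ a, 4 ≤ a → a < 20 → ∀ i, σ.arr a i = 0) (hr : σ.real = I.input.real) :
    IsAllocation ((allocate.run σ).output n m) ∧ I.EF1 ((allocate.run σ).output n m) ∧
      I.opt ≤ 2 * (n : ℝ) ^ 2 * I.socialWelfare ((allocate.run σ).output n m) := by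
  have hn0 : σ.arr 0 0 = n := by simp [Store.arr, h0, FairDivision.input]
  have hm0 : σ.arr 0 1 = m := by simp [Store.arr, h0, FairDivision.input]
  have hr0 : ∀ a, 2 ≤ a → ∀ i g, σ.real a i g = 0 := by
    intro a ha i g
    rw [hr]
    simp only [FairDivision.input]
    split_ifs <;> first | omega | rfl
  have hNm : m ≤ n * m := Nat.le_mul_of_pos_left m hn
  simp only [allocate, run_seq]
  obtain ⟨a, ha, f1, f2⟩ := run_favour (σ := σ) (by omega) (hr0 4 (by omega))
  rw [hn0, hm0] at f2
  rw [hn0] at ha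
  set σ₁ := favour.run σ with hσ₁
  have a0 : σ₁.arr 0 = σ.arr 0 := run_arr _ _ 0 rfl
  have u1 := run_utilities f1 (fun i g => by rw [run_real _ _ 2 rfl]; exact hr0 2 le_rfl i g)
    fun b i g hig hb => by
      rw [run_arr _ _ 0 rfl, hn0, hm0] at hig
      have : σ₁.real b = σ.real b := by
        interval_cases b
        exacts [run_real _ _ 0 rfl, run_real _ _ 1 rfl]
      rw [this, hr]
      exact I.input_real_of_le hig b
  have r10 : σ₁.real 0 = I.input.real 0 := (run_real _ _ 0 rfl).trans (by rw [hr])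
  have r11 : σ₁.real 1 = I.input.real 1 := (run_real _ _ 1 rfl).trans (by rw [hr])
  rw [r10, r11] at u1
  set σ₂ := utilities.run σ₁ with hσ₂
  have b0 : σ₂.arr 0 = σ.arr 0 := (run_arr _ _ 0 rfl).trans a0
  have b2 : σ₂.arr 2 = σ.arr 2 := (run_arr _ _ 2 rfl).trans (run_arr _ _ 2 rfl)
  have b4 : σ₂.arr 4 = σ₁.arr 4 := run_arr _ _ 4 rfl
  have b5 : σ₂.arr 5 = σ.arr 5 := (run_arr _ _ 5 rfl).trans (run_arr _ _ 5 rfl)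
  have hb := run_label (σ := σ₂) (n := n) (m := m) (a := a) (by rw [b0, hn0]) (by rw [b0, hm0])
    (by rw [b2, hN]) (by rw [b4, f1]) (by rw [b5]; exact hz 5 (by omega) (by omega))
  rw [show σ₂.real 0 = I.input.real 0 from (run_real _ _ 0 rfl).trans r10] at hb
  set σ₃ := label.run σ₂ with hσ₃
  have c0 : σ₃.arr 0 = σ.arr 0 := (run_arr _ _ 0 rfl).trans b0
  have c2 : σ₃.arr 2 = σ.arr 2 := (run_arr _ _ 2 rfl).trans b2
  have c4 : σ₃.arr 4 = σ₁.arr 4 := (run_arr _ _ 4 rfl).trans b4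
  have cu : σ₃.real 2 = σ₂.real 2 := run_real _ _ 2 rfl
  obtain ⟨g, hg, g1, g2⟩ := run_findBest (σ := σ₃) (a := a) (by rw [c4, f1])
    (by rw [c2, hN]; omega)
  rw [c2, hN] at hg g2
  rw [cu] at g2
  set σ₄ := findBest.run σ₃ with hσ₄
  have d0 : σ₄.arr 0 = σ.arr 0 := (run_arr _ _ 0 rfl).trans c0
  have hi := run_initBundles σ₄
  rw [d0, hn0] at hi
  set σ₅ := initBundles.run σ₄ with hσ₅
  have e0 : σ₅.arr 0 = σ.arr 0 := (run_arr _ _ 0 rfl).trans d0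
  have e2 : σ₅.arr 2 = σ.arr 2 := (run_arr _ _ 2 rfl).trans ((run_arr _ _ 2 rfl).trans c2)
  have e3 : σ₅.arr 3 = σ.arr 3 := (run_arr _ _ 3 rfl).trans <| (run_arr _ _ 3 rfl).trans <|
    (run_arr _ _ 3 rfl).trans <| (run_arr _ _ 3 rfl).trans (run_arr _ _ 3 rfl)
  have e4 : σ₅.arr 4 = σ₁.arr 4 := (run_arr _ _ 4 rfl).trans ((run_arr _ _ 4 rfl).trans c4)
  have e5 : σ₅.arr 5 = σ₃.arr 5 := (run_arr _ _ 5 rfl).trans (run_arr _ _ 5 rfl)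
  have e6 : σ₅.arr 6 = σ.arr 6 := (run_arr _ _ 6 rfl).trans <| (run_arr _ _ 6 rfl).trans <|
    (run_arr _ _ 6 rfl).trans <| (run_arr _ _ 6 rfl).trans (run_arr _ _ 6 rfl)
  have e14 : σ₅.arr 14 = σ₄.arr 14 := run_arr _ _ 14 rfl
  have e15 : σ₅.arr 15 = σ.arr 15 := (run_arr _ _ 15 rfl).trans <| (run_arr _ _ 15 rfl).trans <|
    (run_arr _ _ 15 rfl).trans <| (run_arr _ _ 15 rfl).trans (run_arr _ _ 15 rfl)
  have eu : σ₅.real 2 = σ₂.real 2 := (run_real _ _ 2 rfl).trans ((run_real _ _ 2 rfl).trans cu)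
  have eW : σ₅.real 3 = σ.real 3 := (run_real _ _ 3 rfl).trans <| (run_real _ _ 3 rfl).trans <|
    (run_real _ _ 3 rfl).trans <| (run_real _ _ 3 rfl).trans (run_real _ _ 3 rfl)
  have hu : ∀ i g, 0 ≤ σ₂.real 2 i g := by
    intro i g
    rw [u1]
    split_ifs <;> exact I.input_nonneg _ _ _
  have hall := run_handOutAll (σ := σ₅) (n := n) (m := m) (a := a) (g := g)
    (v := I.input.real 0 a)
  rw [e0, e2, e3, e4, e5, e6, e14, e15, eu, eW] at hall
  obtain ⟨k1, k2, k3⟩ := hall hn0 hm0 hN hQ f1 ha hu hb g1 hg (hz 15 (by omega) (by omega))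
    (hz 6 (by omega) (by omega)) (hr0 3 (by omega)) hi
  set σ₆ := handOutAll.run σ₅ with hσ₆
  have l0 : σ₆.arr 0 = σ.arr 0 := (run_arr _ _ 0 rfl).trans e0
  have ho := run_writeOutput (σ := σ₆)
  rw [l0, hn0, hm0] at ho
  rw [hr] at f2
  exact I.output_of_bundleState hNm hm ha u1 k1 k2 hb f2 (fun g' hg' => (g2 g' hg').trans k3)
    (ho k1.isAssignment)

end LoopProg

/-! ### The case without goods and the final assembly -/

theorem output_of_no_goods {n : ℕ} (I : FairDivision n 0) (σ : Store) :
    IsAllocation (σ.output n 0) ∧ I.EF1 (σ.output n 0) ∧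
      I.opt ≤ 2 * (n : ℝ) ^ 2 * I.socialWelfare (σ.output n 0) := by
  have hA : IsAllocation (σ.output n 0) :=
    ⟨fun i j _ => Finset.disjoint_left.2 fun g => g.elim0, fun g => g.elim0⟩
  have hW : ∀ A, I.socialWelfare A = 0 := fun A =>
    Finset.sum_eq_zero fun i _ => Finset.sum_eq_zero fun g _ => g.elim0
  refine ⟨hA, fun i j => Or.inl (Finset.eq_empty_of_forall_notMem fun g => g.elim0), ?_⟩
  rw [hW, mul_zero]
  refine csSup_le ⟨_, _, hA, rfl⟩ ?_
  rintro x ⟨A, -, rfl⟩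
  rw [hW]

end SocialImpact

open SocialImpact LoopProg in
theorem theorem4 :
    ∃ (P : SocialImpact.Prog) (p : Polynomial ℕ),
      ∀ (n m : ℕ), 1 ≤ n → ∀ (I : SocialImpact.FairDivision n m),
        ∃ (σ : SocialImpact.Store) (t : ℕ),
          SocialImpact.Runs P I.input σ t ∧
          t ≤ p.eval (n + m) ∧
          SocialImpact.IsAllocation (σ.output n m) ∧
          I.EF1 (σ.output n m) ∧
          I.opt ≤ 2 * (n : ℝ) ^ 2 * I.socialWelfare (σ.output n m) := by
  refine ⟨.seq sizes.compile allocate.compile,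
    -- All loop bounds, namely $n$, $m$, $nm$ and $n^2+1$, are at most $(n+m)^2+1$.
    (sizes.timeBound + allocate.timeBound).comp (Polynomial.X ^ 2 + 1), fun n m hn I => ?_⟩
  have hnm : n + m ≤ (n + m) ^ 2 := Nat.le_self_pow two_ne_zero _
  have hL : ∀ i, I.input.nat 0 i 0 ≤ (n + m) ^ 2 + 1 := by
    intro i
    simp only [FairDivision.input]
    split_ifs <;> omega
  have hz : ∀ a, 1 ≤ a → ∀ i, I.input.arr a i = 0 := by
    intro a ha i
    simp [Store.arr, FairDivision.input, show a ≠ 0 by omega]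
  obtain ⟨s2, s3⟩ := run_sizes (hz 2 (by omega) 0) (hz 3 (by omega) 0)
  have i0 : I.input.arr 0 0 = n := by simp [Store.arr, FairDivision.input]
  have i1 : I.input.arr 0 1 = m := by simp [Store.arr, FairDivision.input]
  rw [i0, i1] at s2
  rw [i0] at s3
  have s0 : (sizes.run I.input).nat 0 = I.input.nat 0 := (frame_run _ _).1 0 rfl
  -- The time bound is applied twice because arrays 2 and 3 are written by `sizes` and can serve as
  -- loop bounds only afterwards.
  obtain ⟨t, ht, hrun⟩ := exists_runs (S := [0]) (p := sizes) rfl (L := (n + m) ^ 2 + 1)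
    (σ := I.input) (by simpa using hL)
  obtain ⟨t', ht', hrun'⟩ := exists_runs (S := [0, 2, 3]) (p := allocate) rfl
    (L := (n + m) ^ 2 + 1) (σ := sizes.run I.input) (by
      simp only [List.mem_cons, List.not_mem_nil, or_false, forall_eq_or_imp, forall_eq, s0,
        Store.nat_eq_arr _ 2, Store.nat_eq_arr _ 3, s2, s3, Function.update_apply]
      refine ⟨hL, fun i => ?_, fun i => ?_⟩
      · split_ifs
        · nlinarith
        · simp [hz 2]
      · split_ifs
        · nlinarith
        · simp [hz 3])
  refine ⟨_, _, .seq hrun hrun', ?_, ?_⟩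
  · simp only [Polynomial.eval_comp, Polynomial.eval_add, Polynomial.eval_pow, Polynomial.eval_X,
      Polynomial.eval_one]
    omega
  -- Without goods there is no best good to start from, but the program still halts in time and any
  -- final memory stands for the empty allocation.
  · rcases Nat.eq_zero_or_pos m with rfl | hm
    · exact output_of_no_goods I _
    · refine run_allocate I hn hm s0 (by rw [s2]; simp) (by rw [s3]; simp)
        (fun a h4 h20 i => ?_) ?_
      · rw [run_arr _ _ a (by simp [sizes, writesNat]; omega), hz a (by omega)]
      · funext a
        exact run_real _ _ a rfl
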